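/- Let $-\infty\le a\le b\le\infty$ and let $D[a,b]$ be the space of càdlàg functions $[a,b]\to\mathbb R$ with the supremum norm. For $f\in D[a,b]$ write $f(u-)$ for the left limit and $\Delta f(u)=f(u)-f(u-)$ for $u\in(a,b]$. For $0\le M<\infty$ let $BV_M^{>-1}[a,b]\subset D[a,b]$ be the set of those $A$ whose total variation is at most $M$ and whose jumps lie in $(-1,\infty)$ and are bounded away from $-1$, i.e. there is $\delta>0$ (depending on $A$) with $\Delta A(u)\ge -1+\delta$ for all $u\in(a,b]$. For every $A\in BV_M^{>-1}[a,b]$ and $t\in[a,b]$ the product integral $$\phi(A)(t)=\prod_{u\in(a,t]}(1+A(du)),$$ i.e. the limit, under refinement of the finite partitions $a=u_0\le u_1\le\dots\le u_n=t$, of $\prod_{i=1}^{n}\bigl(1+A(u_i)-A(u_{i-1})\bigr)$, exists; the function $\phi(A)$ belongs to $D[a,b]$, has bounded variation and is bounded below by a positive constant. Moreover, $\phi:BV_M^{>-1}[a,b]\subset D[a,b]\to D[a,b]$ is uniformly Hadamard differentiable at every $A\in BV_M^{>-1}[a,b]$: there is a continuous linear map $\phi'_A:D[a,b]\to D[a,b]$,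 given by $$\phi'_A(\alpha)(t)=\int_{(a,t]}\phi(A)(u-)\,\frac{\phi(A)(t)}{\phi(A)(u)}\,d\alpha(u),\qquad \alpha\in D[a,b],\ t\in[a,b],$$ such that $$t_n^{-1}\bigl(\phi(A_n+t_n\alpha_n)-\phi(A_n)\bigr)\to\phi'_A(\alpha)\quad\text{in } D[a,b]$$ whenever $t_n\in\mathbb R\setminus\{0\}$, $t_n\to0$, $\alpha_n,\alpha\in D[a,b]$ with $\|\alpha_n-\alpha\|_\infty\to0$, $\|A_n-A\|_\infty\to0$, and $A_n,\ A_n+t_n\alpha_n\in BV_M^{>-1}[a,b]$ for all $n$. Here the integral with respect to $\alpha$ is the Lebesgue–Stieltjes integral if $\alpha$ has bounded variation; otherwise it is defined by integration by parts: with $U=\phi(A)$ and $V=\phi(A)(t)/\phi(A)(\cdot)$, $$\int_{(a,t]}U(u-)V(u)\,d\alpha(u):=U(t)V(t)\alpha(t)-U(a)V(a)\alpha(a)-\int_{(a,t]}U(u-)\alpha(u-)\,dV(u)-\int_{(a,t]}V(u)\alpha(u)\,dU(u).$$ -/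

import Mathlib

open Set Filter Topology MeasureTheory
open scoped NNReal ENNReal

noncomputable section

/-- A function on `[a, b]` is càdlàg if it is right-continuous and has (finite) left limits. -/
def IsCadlag {a b : EReal} (f : Icc a b → ℝ) : Prop :=
  (∀ x, ContinuousWithinAt f (Ici x) x) ∧ ∀ x, ∃ l : ℝ, Tendsto f (𝓝[<] x) (𝓝 l)

/-- The space `D[a, b]` of càdlàg functions, as a subspace of the bounded functions on `[a, b]` with
the supremum norm (a càdlàg function on a compact interval is bounded). -/
def CadlagSpace (a b : EReal) : Submodule ℝ (lp (fun _ : Icc a b => ℝ) ∞) where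
  carrier := {f | IsCadlag (f : Icc a b → ℝ)}
  zero_mem' := ⟨fun _ => continuousWithinAt_const, fun _ => ⟨0, tendsto_const_nhds⟩⟩
  add_mem' := by
    rintro f g ⟨hf, hf'⟩ ⟨hg, hg'⟩
    refine ⟨fun x => (hf x).add (hg x), fun x => ?_⟩
    obtain ⟨l, hl⟩ := hf' x
    obtain ⟨m, hm⟩ := hg' x
    exact ⟨l + m, hl.add hm⟩
  smul_mem' := by
    rintro c f ⟨hf, hf'⟩
    refine ⟨fun x => (hf x).const_smul c, fun x => ?_⟩
    obtain ⟨l, hl⟩ := hf' x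
    exact ⟨c • l, hl.const_smul c⟩

instance (a b : EReal) : CoeFun (CadlagSpace a b) (fun _ => Icc a b → ℝ) :=
  ⟨fun f => ((f : lp (fun _ : Icc a b => ℝ) ∞) : Icc a b → ℝ)⟩

/-- The functions `A ∈ D[a, b]` with total variation at most `M` whose jumps
`ΔA(u) = A(u) - A(u-)` lie in `(-1, ∞)` and are bounded away from `-1`.
(At the left endpoint `leftLim A a = A a`, so that there is no jump.) -/
def BVGtNegOne (a b : EReal) (M : ℝ≥0) : Set (CadlagSpace a b) :=
  {A | eVariationOn A univ ≤ M ∧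
    ∃ δ : ℝ, 0 < δ ∧ ∀ u : Icc a b, -1 + δ ≤ A u - Function.leftLim A u}

/-- `p` is the product integral `∏_{u ∈ (a, t]} (1 + A(du))`: the limit, under refinement of the
finite partitions `a = u 0 ≤ u 1 ≤ ⋯ ≤ u n = t`, of the products
`∏ i, (1 + A (u (i + 1)) - A (u i))`. -/
def HasProductIntegral {a b : EReal} (A : Icc a b → ℝ) (t : Icc a b) (p : ℝ) : Prop :=
  ∀ ε : ℝ, 0 < ε → ∃ s : Finset (Icc a b), ∀ (n : ℕ) (u : ℕ → Icc a b),
    Monotone u → (u 0 : EReal) = a → u n = t → (∀ x ∈ s, x ≤ t → ∃ i ≤ n, u i = x) →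
      |∏ i ∈ Finset.range n, (1 + (A (u (i + 1)) - A (u i))) - p| < ε

open Classical in
/-- The product-integral functional `A ↦ ∏_{u ∈ (a, ·]} (1 + A(du))` with values in `D[a, b]`
(with value `0` if the product integral does not exist as an element of `D[a, b]`). -/
def productIntegral {a b : EReal} (A : CadlagSpace a b) : CadlagSpace a b :=
  if h : ∃ F : CadlagSpace a b, ∀ t, HasProductIntegral A t (F t) then h.choose else 0

instance (a b : EReal) : CompactIccSpace (Icc a b) where
  isCompact_Icc := fun {x y} => by
    rw [Subtype.isCompact_iff]
    have h : ((↑) : Icc a b → EReal) '' Icc x y = Icc (x : EReal) y := by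
      ext z
      constructor
      · rintro ⟨w, hw, rfl⟩
        exact hw
      · rintro ⟨h1, h2⟩
        exact ⟨⟨z, x.2.1.trans h1, h2.trans y.2.2⟩, ⟨h1, h2⟩, rfl⟩
    rw [h]
    exact isCompact_Icc

/-- Lebesgue–Stieltjes integral `∫_{(x, t]} f dg` for `g` of bounded variation (and `0`
otherwise). -/
def lsIntegral {a b : EReal} (f g : Icc a b → ℝ) (x t : Icc a b) : ℝ :=
  open Classical in
  if hg : BoundedVariationOn g univ then ∫ᵛ u in Ioc x t, f u ∂•hg.vectorMeasure else 0

/-- The integral `∫_{(x, t]} U(u-) V(u) dα(u)` for càdlàg `U`, `V` of bounded variation and `α`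
càdlàg. It is the Lebesgue–Stieltjes integral if `α` has bounded variation; otherwise it is defined
by integration by parts, that is, through the formula
`d(U V α) = U₋ V dα + U₋ α₋ dV + V α dU`. -/
def leftRightIntegral {a b : EReal} (U V α : Icc a b → ℝ) (x t : Icc a b) : ℝ :=
  open Classical in
  if BoundedVariationOn α univ then
    lsIntegral (fun u => Function.leftLim U u * V u) α x t
  else
    U t * V t * α t - U x * V x * α x
      - lsIntegral (fun u => Function.leftLim U u * Function.leftLim α u) V x t
      - lsIntegral (fun u => V u * α u) U x t

/-- `φ`, defined on `S`, is uniformly Hadamard differentiable at `θ ∈ S` (tangentially to the whole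
space) with the continuous linear map `φ'` as its derivative. -/
def HasUniformHadamardDerivAt {D E : Type*} [AddCommGroup D] [Module ℝ D] [TopologicalSpace D]
    [AddCommGroup E] [Module ℝ E] [TopologicalSpace E]
    (φ : D → E) (S : Set D) (φ' : D →L[ℝ] E) (θ : D) : Prop :=
  θ ∈ S ∧ ∀ (t : ℕ → ℝ) (h θs : ℕ → D) (h₀ : D),
    (∀ n, t n ≠ 0) → Tendsto t atTop (𝓝 0) → Tendsto h atTop (𝓝 h₀) → Tendsto θs atTop (𝓝 θ) →
    (∀ n, θs n ∈ S) → (∀ n, θs n + t n • h n ∈ S) →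
      Tendsto (fun n => (t n)⁻¹ • (φ (θs n + t n • h n) - φ (θs n))) atTop (𝓝 (φ' h₀))

end

/-! On a fixed partition everything reduces to algebra of finite products. Duhamel's identity
(`headProd_sub_headProd`) writes the difference of two products as a sum of (head product of `y` up
to `i`) times (tail product of `x` from `i + 1`) times the increment of `y - x`. Both weights have
sup norm and variation bounded in terms of `M` alone, so summation by parts bounds the sum by the
sup norm of `y - x` (`abs_rsSum_le`). Hence the discrete product is Lipschitz for the sup norm on
paths of variation at most `M`, uniformly over partitions.

Existence of the limit follows: a càdlàg function on a compact interval is uniformly close to a step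
function (`Regulated`; the cells are half-open, closed on the left), and the product of a step
function is the same on every partition containing its jumps (`exists_productIntegral`). The
discrete bounds pass to the limit and show that `φ(A)` is càdlàg, of bounded variation and, thanks
to the jump condition, bounded below.

For differentiability, Duhamel's identity turns the difference quotient into a Riemann–Stieltjes sum
with integrator `α_n`. Its weights converge uniformly to `φ(A)` and `φ(A)(t)/φ(A)`, but `α` may have
infinite variation. It is therefore replaced by a step function `β` within `ε` of it: this costs a
multiple of `ε` by summation by parts, while for `β`, of finite variation `V`, exchanging the
weights costs `V` times their sup distance. Letting `n → ∞` first and `ε → 0` afterwards gives the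
claim (`exists_hadamard_bound`).

Finally the limit of the sums has to be the prescribed integral. Since `rsSum` pairs `p i` with `q
(i + 1)`, the first weight becomes a left limit and the second a value. Dominated errors settle this
for integrators of bounded variation (`exists_rsSum_sub_integral_le`), and summation by parts
reduces the general case to that one (`isRSInt_leftRightIntegral`). -/

/-! ### Discrete product integrals -/

/-- The variation of the sequence `x` over `0, …, n`. -/
def seqVar (x : ℕ → ℝ) (n : ℕ) : ℝ := ∑ i ∈ Finset.range n, |x (i + 1) - x i|

/-- The product `∏_{j < n} (1 + (x (j + 1) - x j))`. -/
def headProd (x : ℕ → ℝ) (n : ℕ) : ℝ := ∏ j ∈ Finset.range n, (1 + (x (j + 1) - x j))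

/-- The product `∏_{i ≤ j < n} (1 + (x (j + 1) - x j))`. -/
def tailProd (x : ℕ → ℝ) (n i : ℕ) : ℝ := ∏ j ∈ Finset.Ico i n, (1 + (x (j + 1) - x j))

/-- The Riemann–Stieltjes sum `∑_{i < n} p i * q (i + 1) * (D (i + 1) - D i)`. -/
def rsSum (p q D : ℕ → ℝ) (n : ℕ) : ℝ :=
  ∑ i ∈ Finset.range n, p i * q (i + 1) * (D (i + 1) - D i)

lemma seqVar_nonneg (x : ℕ → ℝ) (n : ℕ) : 0 ≤ seqVar x n :=
  Finset.sum_nonneg fun _ _ => abs_nonneg _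

lemma seqVar_mono (x : ℕ → ℝ) {m n : ℕ} (h : m ≤ n) : seqVar x m ≤ seqVar x n :=
  Finset.sum_le_sum_of_subset_of_nonneg (Finset.range_mono h) fun _ _ _ => abs_nonneg _

lemma abs_prod_one_add_le (s : Finset ℕ) (a : ℕ → ℝ) :
    |∏ i ∈ s, (1 + a i)| ≤ Real.exp (∑ i ∈ s, |a i|) := by
  rw [Finset.abs_prod, Real.exp_sum]
  refine Finset.prod_le_prod (fun _ _ => abs_nonneg _) fun i _ => ?_
  calc |1 + a i| ≤ |1| + |a i| := abs_add_le _ _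
    _ = |a i| + 1 := by rw [abs_one, add_comm]
    _ ≤ _ := Real.add_one_le_exp _

lemma abs_headProd_le {x : ℕ → ℝ} {n i : ℕ} {M : ℝ} (hM : seqVar x n ≤ M) (hi : i ≤ n) :
    |headProd x i| ≤ Real.exp M :=
  (abs_prod_one_add_le _ _).trans (Real.exp_le_exp.2 ((seqVar_mono x hi).trans hM))

lemma abs_tailProd_le {x : ℕ → ℝ} {n : ℕ} {M : ℝ} (hM : seqVar x n ≤ M) (i : ℕ) :
    |tailProd x n i| ≤ Real.exp M := by
  refine (abs_prod_one_add_le _ _).trans (Real.exp_le_exp.2 (le_trans ?_ hM))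
  refine Finset.sum_le_sum_of_subset_of_nonneg (fun j hj => ?_) fun _ _ _ => abs_nonneg _
  simp only [Finset.mem_Ico, Finset.mem_range] at hj ⊢
  exact hj.2

lemma headProd_succ (x : ℕ → ℝ) (n : ℕ) :
    headProd x (n + 1) = headProd x n * (1 + (x (n + 1) - x n)) :=
  Finset.prod_range_succ _ _

lemma tailProd_of_lt (x : ℕ → ℝ) {n i : ℕ} (h : i < n) :
    tailProd x n i = (1 + (x (i + 1) - x i)) * tailProd x n (i + 1) :=
  Finset.prod_eq_prod_Ico_succ_bot h _

lemma headProd_mul_tailProd (x : ℕ → ℝ) {n i : ℕ} (h : i ≤ n) :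
    headProd x i * tailProd x n i = headProd x n :=
  Finset.prod_range_mul_prod_Ico _ h

lemma seqVar_headProd_le {x : ℕ → ℝ} {n : ℕ} {M : ℝ} (hM : seqVar x n ≤ M) :
    seqVar (headProd x) n ≤ Real.exp M * M := by
  calc seqVar (headProd x) n
      ≤ ∑ i ∈ Finset.range n, Real.exp M * |x (i + 1) - x i| := by
        refine Finset.sum_le_sum fun i hi => ?_
        rw [headProd_succ, show headProd x i * (1 + (x (i + 1) - x i)) - headProd x i
          = headProd x i * (x (i + 1) - x i) by ring, abs_mul]
        exact mul_le_mul_of_nonneg_right (abs_headProd_le hM (Finset.mem_range.1 hi).le)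
          (abs_nonneg _)
    _ = Real.exp M * seqVar x n := by rw [← Finset.mul_sum]; rfl
    _ ≤ _ := mul_le_mul_of_nonneg_left hM (Real.exp_pos _).le

lemma seqVar_tailProd_le {x : ℕ → ℝ} {n : ℕ} {M : ℝ} (hM : seqVar x n ≤ M) :
    seqVar (tailProd x n) n ≤ Real.exp M * M := by
  calc seqVar (tailProd x n) n
      ≤ ∑ i ∈ Finset.range n, Real.exp M * |x (i + 1) - x i| := by
        refine Finset.sum_le_sum fun i hi => ?_
        rw [tailProd_of_lt x (Finset.mem_range.1 hi),
          show tailProd x n (i + 1) - (1 + (x (i + 1) - x i)) * tailProd x n (i + 1)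
          = -(tailProd x n (i + 1) * (x (i + 1) - x i)) by ring, abs_neg, abs_mul]
        exact mul_le_mul_of_nonneg_right (abs_tailProd_le hM _) (abs_nonneg _)
    _ = Real.exp M * seqVar x n := by rw [← Finset.mul_sum]; rfl
    _ ≤ _ := mul_le_mul_of_nonneg_left hM (Real.exp_pos _).le

/-- Duhamel's formula for discrete product integrals. -/
lemma headProd_sub_headProd (x y : ℕ → ℝ) (n : ℕ) :
    headProd y n - headProd x n = rsSum (headProd y) (tailProd x n) (fun i => y i - x i) n := by
  -- The terms telescope: passing from `i` to `i + 1` swaps one factor of `x` for the corresponding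
  -- factor of `y`.
  have key : ∀ i ∈ Finset.range n,
      headProd y i * tailProd x n (i + 1) * ((y (i + 1) - x (i + 1)) - (y i - x i)) =
        headProd y (i + 1) * tailProd x n (i + 1) - headProd y i * tailProd x n i := by
    intro i hi
    rw [headProd_succ, tailProd_of_lt x (Finset.mem_range.1 hi)]
    ring
  rw [rsSum, Finset.sum_congr rfl key,
    Finset.sum_range_sub (fun i => headProd y i * tailProd x n i),
    ← headProd_mul_tailProd x n.zero_le]
  simp [tailProd, headProd]

/-- Summation by parts for a product of three sequences. -/
lemma rsSum_by_parts (p q D : ℕ → ℝ) (n : ℕ) :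
    rsSum p q D n = p n * q n * D n - p 0 * q 0 * D 0
      - rsSum (fun i => p i * D i) 1 q n - rsSum 1 (fun i => q i * D i) p n := by
  have h := Finset.sum_range_sub (fun i => p i * q i * D i) n
  rw [← h, rsSum, rsSum, rsSum, ← Finset.sum_sub_distrib, ← Finset.sum_sub_distrib]
  refine Finset.sum_congr rfl fun i _ => ?_
  simp only [Pi.one_apply]
  ring

lemma abs_rsSum_le_var {p q D : ℕ → ℝ} {n : ℕ} {K L : ℝ}
    (hp : ∀ i ≤ n, |p i| ≤ K) (hq : ∀ i ≤ n, |q i| ≤ L) :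
    |rsSum p q D n| ≤ K * L * seqVar D n := by
  have hK : 0 ≤ K := (abs_nonneg _).trans (hp 0 n.zero_le)
  have hL : 0 ≤ L := (abs_nonneg _).trans (hq 0 n.zero_le)
  refine (Finset.abs_sum_le_sum_abs _ _).trans ?_
  rw [seqVar, Finset.mul_sum]
  refine Finset.sum_le_sum fun i hi => ?_
  have hi := Finset.mem_range.1 hi
  rw [abs_mul, abs_mul]
  gcongr
  exacts [hp i hi.le, hq _ hi]

/-- Summation by parts bounds a Riemann–Stieltjes sum by the supremum of the integrator. -/
lemma abs_rsSum_le {p q D : ℕ → ℝ} {n : ℕ} {K L η : ℝ}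
    (hp : ∀ i ≤ n, |p i| ≤ K) (hq : ∀ i ≤ n, |q i| ≤ K)
    (hpv : seqVar p n ≤ L) (hqv : seqVar q n ≤ L) (hD : ∀ i ≤ n, |D i| ≤ η) :
    |rsSum p q D n| ≤ 2 * K * (K + L) * η := by
  have hK : 0 ≤ K := (abs_nonneg _).trans (hp 0 n.zero_le)
  have hη : 0 ≤ η := (abs_nonneg _).trans (hD 0 n.zero_le)
  have h1 : ∀ i ≤ n, |p i * q i * D i| ≤ K * K * η := fun i hi => by
    rw [abs_mul, abs_mul]
    gcongr
    exacts [hp i hi, hq i hi, hD i hi]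
  have h2 : |rsSum (fun i => p i * D i) 1 q n| ≤ K * η * 1 * seqVar q n :=
    abs_rsSum_le_var (fun i hi => by
      rw [abs_mul]; gcongr; exacts [hp i hi, hD i hi]) fun i _ => by simp
  have h3 : |rsSum 1 (fun i => q i * D i) p n| ≤ 1 * (K * η) * seqVar p n :=
    abs_rsSum_le_var (fun i _ => by simp) fun i hi => by
      rw [abs_mul]; gcongr; exacts [hq i hi, hD i hi]
  have h4 : K * η * 1 * seqVar q n ≤ K * η * L := by
    rw [mul_one]; gcongr
  have h5 : 1 * (K * η) * seqVar p n ≤ K * η * L := by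
    rw [one_mul]; gcongr
  -- Each of the two boundary terms is at most `K * K * η`, each of the two remaining sums at most
  -- `K * L * η`.
  rw [rsSum_by_parts]
  have h6 := h1 n le_rfl
  have h7 := h1 0 n.zero_le
  rw [abs_le] at *
  constructor <;> nlinarith

/-- The Lipschitz constant of the product integral on paths of variation at most `M`. -/
noncomputable def lipConst (M : ℝ) : ℝ := 2 * Real.exp M * (Real.exp M + Real.exp M * M)

lemma lipConst_nonneg {M : ℝ} (hM : 0 ≤ M) : 0 ≤ lipConst M := by
  unfold lipConst; positivity

lemma abs_rsSum_prods_le {x y D : ℕ → ℝ} {n : ℕ} {M η : ℝ} (hx : seqVar x n ≤ M)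
    (hy : seqVar y n ≤ M) (hD : ∀ i ≤ n, |D i| ≤ η) :
    |rsSum (headProd y) (tailProd x n) D n| ≤ lipConst M * η :=
  abs_rsSum_le (fun _ hi => abs_headProd_le hy hi) (fun _ _ => abs_tailProd_le hx _)
    (seqVar_headProd_le hy) (seqVar_tailProd_le hx) hD

/-- Duhamel's formula with summation by parts: only the sup distance of the paths enters, and the
constant is independent of the number of factors. This is the estimate behind existence, regularity
and differentiability. -/
lemma abs_headProd_sub_le {x y : ℕ → ℝ} {n : ℕ} {M η : ℝ} (hx : seqVar x n ≤ M)
    (hy : seqVar y n ≤ M) (hD : ∀ i ≤ n, |y i - x i| ≤ η) :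
    |headProd y n - headProd x n| ≤ lipConst M * η := by
  rw [headProd_sub_headProd]
  exact abs_rsSum_prods_le hx hy hD

lemma abs_tailProd_sub_le {x y : ℕ → ℝ} {n k : ℕ} {M η : ℝ} (hx : seqVar x n ≤ M)
    (hy : seqVar y n ≤ M) (hD : ∀ i ≤ n, |y i - x i| ≤ η) :
    |tailProd y n k - tailProd x n k| ≤ lipConst M * η := by
  rcases le_total n k with h | h
  · have hM : 0 ≤ M := (seqVar_nonneg x n).trans hx
    have hη : 0 ≤ η := (abs_nonneg _).trans (hD 0 n.zero_le)
    simp only [tailProd, Finset.Ico_eq_empty_of_le h, Finset.prod_empty, sub_self, abs_zero]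
    exact mul_nonneg (lipConst_nonneg hM) hη
  · have key : ∀ z : ℕ → ℝ, tailProd z n k = headProd (fun i => z (k + i)) (n - k) := fun z =>
      Finset.prod_Ico_eq_prod_range _ _ _
    have hv : ∀ z : ℕ → ℝ, seqVar (fun i => z (k + i)) (n - k) ≤ seqVar z n := fun z => by
      refine (Finset.sum_Ico_eq_sum_range (fun i => |z (i + 1) - z i|) k n).symm.le.trans ?_
      refine Finset.sum_le_sum_of_subset_of_nonneg (fun j hj => ?_) fun _ _ _ => abs_nonneg _
      simp only [Finset.mem_Ico, Finset.mem_range] at hj ⊢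
      exact hj.2
    rw [key, key]
    exact abs_headProd_sub_le ((hv x).trans hx) ((hv y).trans hy) fun i hi => hD _ (by omega)

/-- Stopping a path at `k` turns a comparison of two times into a comparison of two paths up to the
same time, so that sup-norm estimates also control oscillation. -/
lemma seqVar_stop_le (x : ℕ → ℝ) (k n : ℕ) : seqVar (fun i => x (min i k)) n ≤ seqVar x n := by
  refine Finset.sum_le_sum fun i _ => ?_
  rcases le_total (i + 1) k with h | h
  · simp [min_eq_left h, min_eq_left (Nat.le_of_succ_le h)]
  · rcases h.eq_or_lt with h | h
    · simp [h]
    · simp [min_eq_right h.le, min_eq_right (Nat.lt_succ_iff.1 h)]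

lemma headProd_stop (x : ℕ → ℝ) {k n : ℕ} (h : k ≤ n) :
    headProd (fun i => x (min i k)) n = headProd x k := by
  induction n, h using Nat.le_induction with
  | base =>
    refine Finset.prod_congr rfl fun i hi => ?_
    have hi := Finset.mem_range.1 hi
    simp only [min_eq_left hi.le, min_eq_left (Nat.succ_le_of_lt hi)]
  | succ n hn ih =>
    rw [headProd_succ, ih]
    simp [min_eq_right hn, min_eq_right (hn.trans n.le_succ)]

lemma rsSum_succ (p q x : ℕ → ℝ) (n : ℕ) :
    rsSum p q x (n + 1) = rsSum p q x n + p n * q (n + 1) * (x (n + 1) - x n) :=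
  Finset.sum_range_succ _ _

lemma rsSum_stop (p q x : ℕ → ℝ) {k n : ℕ} (h : k ≤ n) :
    rsSum p q (fun i => x (min i k)) n = rsSum p q x k := by
  induction n, h using Nat.le_induction with
  | base =>
    refine Finset.sum_congr rfl fun i hi => ?_
    have hi := Finset.mem_range.1 hi
    simp only [min_eq_left hi.le, min_eq_left (Nat.succ_le_of_lt hi)]
  | succ n hn ih =>
    rw [rsSum_succ, ih]
    simp [min_eq_right hn, min_eq_right (hn.trans n.le_succ)]

lemma abs_sub_stop_le {x : ℕ → ℝ} {k n : ℕ} {η : ℝ} (hη : 0 ≤ η)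
    (hD : ∀ i, k ≤ i → i ≤ n → |x i - x k| ≤ η) {i : ℕ} (hi : i ≤ n) :
    |x i - x (min i k)| ≤ η := by
  rcases le_total i k with h | h
  · simpa [min_eq_left h] using hη
  · simpa [min_eq_right h] using hD i h hi

lemma abs_headProd_sub_headProd_le {x : ℕ → ℝ} {k n : ℕ} {M η : ℝ} (h : k ≤ n)
    (hx : seqVar x n ≤ M) (hη : 0 ≤ η) (hD : ∀ i, k ≤ i → i ≤ n → |x i - x k| ≤ η) :
    |headProd x n - headProd x k| ≤ lipConst M * η := by
  rw [← headProd_stop x h]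
  exact abs_headProd_sub_le ((seqVar_stop_le x k n).trans hx) hx
    fun i hi => abs_sub_stop_le hη hD hi

lemma rsSum_sub (p q D E : ℕ → ℝ) (n : ℕ) :
    rsSum p q (fun i => D i - E i) n = rsSum p q D n - rsSum p q E n := by
  rw [rsSum, rsSum, rsSum, ← Finset.sum_sub_distrib]
  exact Finset.sum_congr rfl fun i _ => by ring

lemma abs_rsSum_sub_rsSum_le {p q D : ℕ → ℝ} {k n : ℕ} {K L η : ℝ} (h : k ≤ n)
    (hp : ∀ i ≤ n, |p i| ≤ K) (hq : ∀ i ≤ n, |q i| ≤ K)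
    (hpv : seqVar p n ≤ L) (hqv : seqVar q n ≤ L) (hη : 0 ≤ η)
    (hD : ∀ i, k ≤ i → i ≤ n → |D i - D k| ≤ η) :
    |rsSum p q D n - rsSum p q D k| ≤ 2 * K * (K + L) * η := by
  rw [← rsSum_stop p q D h, ← rsSum_sub]
  exact abs_rsSum_le hp hq hpv hqv fun i hi => abs_sub_stop_le hη hD hi

lemma abs_headProd_sub_headProd_le_var {x v : ℕ → ℝ} {k n : ℕ} {M : ℝ} (h : k ≤ n)
    (hx : seqVar x n ≤ M) (hv : ∀ i, |x (i + 1) - x i| ≤ v (i + 1) - v i) :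
    |headProd x n - headProd x k| ≤ Real.exp M * (v n - v k) := by
  induction n, h using Nat.le_induction with
  | base => simp
  | succ n hn ih =>
    have hx' := (seqVar_mono x n.le_succ).trans hx
    have h1 := ih hx'
    have h2 : |headProd x (n + 1) - headProd x n| ≤ Real.exp M * (v (n + 1) - v n) := by
      rw [headProd_succ, show headProd x n * (1 + (x (n + 1) - x n)) - headProd x n
          = headProd x n * (x (n + 1) - x n) by ring, abs_mul]
      exact mul_le_mul (abs_headProd_le hx' le_rfl) (hv n) (abs_nonneg _) (Real.exp_pos _).le
    have h3 := abs_sub_le (headProd x (n + 1)) (headProd x n) (headProd x k)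
    linarith

/-- For a factor `1 + y ≥ δ` one has `(1 + y)⁻¹ ≤ 1 + |y| / δ ≤ exp (|y| / δ)`; multiplying over the
factors leaves only the variation in the exponent. -/
lemma exp_neg_le_headProd {x : ℕ → ℝ} {n : ℕ} {M δ : ℝ} (hδ : 0 < δ)
    (hx : seqVar x n ≤ M) (h : ∀ i < n, δ ≤ 1 + (x (i + 1) - x i)) :
    Real.exp (-(M / δ)) ≤ headProd x n := by
  have key : ∀ y : ℝ, δ ≤ 1 + y → Real.exp (-(|y| / δ)) ≤ 1 + y := by
    intro y hy
    have hpos : 0 < 1 + y := hδ.trans_le hy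
    have h1 : |y| / δ ≥ (1 + y)⁻¹ - 1 := by
      rcases le_total 0 y with h0 | h0
      · have : (1 + y)⁻¹ ≤ 1 := inv_le_one_of_one_le₀ (by linarith)
        have : 0 ≤ |y| / δ := by positivity
        linarith
      · rw [abs_of_nonpos h0, show (1 + y)⁻¹ - 1 = -y / (1 + y) by field_simp; ring]
        exact div_le_div_of_nonneg_left (by linarith) hδ hy
    have h2 : (1 + y)⁻¹ ≤ Real.exp (|y| / δ) := by
      have := Real.add_one_le_exp (|y| / δ)
      linarith
    rw [Real.exp_neg]
    exact inv_le_of_inv_le₀ hpos h2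
  calc Real.exp (-(M / δ)) ≤ Real.exp (∑ i ∈ Finset.range n, -(|x (i + 1) - x i| / δ)) := by
        rw [Real.exp_le_exp, Finset.sum_neg_distrib, ← Finset.sum_div]
        exact neg_le_neg (div_le_div_of_nonneg_right hx hδ.le)
    _ = ∏ i ∈ Finset.range n, Real.exp (-(|x (i + 1) - x i| / δ)) := Real.exp_sum _ _
    _ ≤ headProd x n := Finset.prod_le_prod (fun _ _ => (Real.exp_pos _).le)
        fun i hi => key _ (h i (Finset.mem_range.1 hi))

/-! ### Partitions refining a finite set -/

/-- `u 0 ≤ ⋯ ≤ u n` is a partition of `[o, t]` that contains the points of `s` in `[o, t]`. -/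
structure IsRefined {X : Type*} [LinearOrder X] (s : Finset X) (o t : X) (n : ℕ) (u : ℕ → X) :
    Prop where
  mono : Monotone u
  zero : u 0 = o
  last : u n = t
  mem : ∀ x ∈ s, x ≤ t → ∃ i ≤ n, u i = x

/-- `x ≤ y` and there is no point of `s` in `(x, y]`. -/
def SameCell {X : Type*} [LinearOrder X] (s : Finset X) (x y : X) : Prop :=
  x ≤ y ∧ ∀ z ∈ s, x < z → y < z

/-- The function `f` is, up to any error, constant on the cells of a finite set. -/
def Regulated {X : Type*} [LinearOrder X] (f : X → ℝ) : Prop :=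
  ∀ ε : ℝ, 0 < ε → ∃ s : Finset X, ∀ x y, SameCell s x y → |f y - f x| ≤ ε

section Order

variable {X : Type*} [LinearOrder X] {s s' : Finset X} {o t : X} {n : ℕ} {u : ℕ → X}

lemma IsRefined.of_subset (h : IsRefined s o t n u) (hs : s' ⊆ s) : IsRefined s' o t n u :=
  ⟨h.mono, h.zero, h.last, fun x hx => h.mem x (hs hx)⟩

lemma IsRefined.restrict (h : IsRefined s o t n u) {i : ℕ} (hi : i ≤ n) :
    IsRefined s o (u i) i u := by
  refine ⟨h.mono, h.zero, rfl, fun x hx hxi => ?_⟩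
  obtain ⟨j, hj, rfl⟩ := h.mem x hx (hxi.trans (h.last ▸ h.mono hi))
  rcases le_total j i with hji | hji
  · exact ⟨j, hji, rfl⟩
  · exact ⟨i, le_rfl, (h.mono hji).antisymm hxi⟩

lemma IsRefined.gap (h : IsRefined s o t n u) {i : ℕ} (hi : i < n) {z : X} (hz : z ∈ s)
    (hiz : u i < z) : u (i + 1) ≤ z := by
  rcases le_or_gt z t with hzt | hzt
  · obtain ⟨j, -, rfl⟩ := h.mem z hz hzt
    refine h.mono (Nat.succ_le_of_lt ?_)
    by_contra hij
    exact absurd (h.mono (not_lt.1 hij)) (not_le.2 hiz)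
  · exact (h.mono (Nat.succ_le_of_lt hi)).trans (h.last.le.trans hzt.le)

lemma IsRefined.sameCell (h : IsRefined s o t n u) {i : ℕ} (hi : i < n) {x y : X}
    (hx : u i ≤ x) (hxy : x ≤ y) (hy : y < u (i + 1)) : SameCell s x y :=
  ⟨hxy, fun _ hz hxz => hy.trans_le (h.gap hi hz (hx.trans_lt hxz))⟩

lemma SameCell.of_subset {x y : X} (h : SameCell s x y) (hs : s' ⊆ s) : SameCell s' x y :=
  ⟨h.1, fun z hz => h.2 z (hs hz)⟩

lemma SameCell.mid {x y z : X} (h : SameCell s x z) (hxy : x ≤ y) (hyz : y ≤ z) :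
    SameCell s x y :=
  ⟨hxy, fun w hw hxw => hyz.trans_lt (h.2 w hw hxw)⟩

lemma exists_isRefined (ho : ∀ x, o ≤ x) (s : Finset X) (t : X) : ∃ n u, IsRefined s o t n u := by
  classical
  set F : Finset X := insert o (insert t (s.filter (· ≤ t))) with hF
  have hle : ∀ x ∈ F, x ≤ t := by
    intro x hx
    simp only [hF, Finset.mem_insert, Finset.mem_filter] at hx
    rcases hx with rfl | rfl | hx
    exacts [ho t, le_rfl, hx.2]
  obtain ⟨k, hk⟩ : ∃ k, F.card = k + 1 :=
    Nat.exists_eq_succ_of_ne_zero (Finset.card_ne_zero_of_mem (Finset.mem_insert_self _ _))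
  have hsurj : ∀ x ∈ F, ∃ j, F.orderEmbOfFin hk j = x := fun x hx => by
    have : x ∈ Set.range (F.orderEmbOfFin hk) := by rwa [Finset.range_orderEmbOfFin]
    exact this
  -- Truncating the index at `k` keeps the sequence constant after its last point, hence monotone on
  -- all of `ℕ`.
  let u : ℕ → X := fun i => F.orderEmbOfFin hk ⟨min i k, by omega⟩
  have hu : ∀ j : Fin (k + 1), u j = F.orderEmbOfFin hk j := fun j => by
    simp only [u]
    congr 1
    exact Fin.ext (min_eq_left (Nat.lt_succ_iff.1 j.2))
  have humono : Monotone u := fun i j hij =>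
    (F.orderEmbOfFin hk).monotone (min_le_min_right k hij)
  refine ⟨k, u, humono, ?_, ?_, fun x hx hxt => ?_⟩
  · obtain ⟨j, hj⟩ := hsurj o (Finset.mem_insert_self _ _)
    refine le_antisymm ?_ (ho _)
    rw [← hj, ← hu]
    exact humono (Nat.zero_le _)
  · obtain ⟨j, hj⟩ := hsurj t (by simp [hF])
    refine le_antisymm (hle _ (Finset.orderEmbOfFin_mem _ _ _)) ?_
    rw [← hj, ← hu]
    exact humono (Nat.lt_succ_iff.1 j.2)
  · obtain ⟨j, hj⟩ := hsurj x (by simp [hF, hx, hxt])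
    exact ⟨j, Nat.lt_succ_iff.1 j.2, (hu j).trans hj⟩

/-- Choosing one partition for each finite set gives a Cauchy net indexed by finite sets under
inclusion. The hypothesis is uniform in `t`, and so is the resulting convergence. -/
lemma exists_refinement_limit (ho : ∀ x, o ≤ x) {F : ℕ → (ℕ → X) → ℝ}
    (h : ∀ ε : ℝ, 0 < ε → ∃ s : Finset X, ∀ t n u m w, IsRefined s o t n u →
      IsRefined s o t m w → |F n u - F m w| ≤ ε) :
    ∃ φ : X → ℝ, ∀ ε : ℝ, 0 < ε → ∃ s : Finset X, ∀ t n u, IsRefined s o t n u →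
      |F n u - φ t| ≤ ε := by
  classical
  choose N U hNU using fun (t : X) (s : Finset X) => exists_isRefined ho s t
  have hlim : ∀ t, ∃ l, Tendsto (fun s => F (N t s) (U t s)) atTop (𝓝 l) := by
    intro t
    refine cauchySeq_tendsto_of_complete (Metric.cauchySeq_iff.2 fun ε hε => ?_)
    obtain ⟨s, hs⟩ := h (ε / 2) (half_pos hε)
    refine ⟨s, fun s₁ h₁ s₂ h₂ => ?_⟩
    rw [Real.dist_eq]
    exact (hs t _ _ _ _ ((hNU t s₁).of_subset h₁) ((hNU t s₂).of_subset h₂)).trans_lt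
      (half_lt_self hε)
  choose φ hφ using hlim
  refine ⟨φ, fun ε hε => ?_⟩
  obtain ⟨s, hs⟩ := h ε hε
  refine ⟨s, fun t n u hu => ?_⟩
  refine le_of_tendsto ((tendsto_const_nhds.sub (hφ t)).abs) ?_
  filter_upwards [eventually_ge_atTop s] with s₁ h₁
  exact hs t _ _ _ _ hu ((hNU t s₁).of_subset h₁)

/-- The map sending `x` to the largest point of `s ∪ {o}` that is at most `x`. -/
lemma exists_cellFloor (ho : ∀ x, o ≤ x) (s : Finset X) :
    ∃ ρ : X → X, Monotone ρ ∧ (∀ x, ρ x = o ∨ ρ x ∈ s) ∧ (∀ x, SameCell s (ρ x) x) ∧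
      ∀ x y, SameCell s x y → ρ x = ρ y := by
  classical
  have hex : ∀ x, ∃ y, (y = o ∨ y ∈ s) ∧ SameCell s y x := by
    intro x
    obtain ⟨y, hy, hmax⟩ := ((insert o s).filter (· ≤ x)).exists_max_image id
      ⟨o, by simp [ho x]⟩
    simp only [Finset.mem_filter, Finset.mem_insert] at hy hmax
    refine ⟨y, hy.1, hy.2, fun z hz hyz => ?_⟩
    by_contra hzx
    exact absurd (hmax z ⟨Or.inr hz, not_lt.1 hzx⟩) (not_le.2 hyz)
  choose ρ hρ hcell using hex
  have hmono : Monotone ρ := by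
    intro x y hxy
    by_contra hlt
    have hlt := not_le.1 hlt
    rcases hρ x with h | h
    · exact absurd (ho (ρ y)) (not_le.2 (h ▸ hlt))
    · exact absurd ((hcell y).2 _ h hlt) (not_lt.2 ((hcell x).1.trans hxy))
  refine ⟨ρ, hmono, hρ, hcell, fun x y hxy => (hmono hxy.1).antisymm ?_⟩
  by_contra hlt
  have hlt := not_le.1 hlt
  rcases hρ y with h | h
  · exact absurd (ho (ρ x)) (not_le.2 (h ▸ hlt))
  · have h1 := (hcell x).2 _ h hlt
    exact absurd (hxy.2 _ h h1) (not_lt.2 (hcell y).1)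

/-- The product integral of a step function is attained on every fine enough partition. -/
lemma exists_headProd_eq_of_step (ho : ∀ x, o ≤ x) {g : X → ℝ}
    (hg : ∀ x y, SameCell s x y → g x = g y) :
    ∃ c : X → ℝ, ∀ t n u, IsRefined s o t n u → headProd (fun i => g (u i)) n = c t := by
  classical
  -- `J x` is the factor contributed by the jump at `x`, computed from any earlier point with no
  -- point of `s` strictly in between. The default `1` is only taken at `x = o`, which the products
  -- below omit.
  let J : X → ℝ := fun x =>
    if h : ∃ y, y < x ∧ ∀ z ∈ s, y < z → x ≤ z then 1 + (g x - g h.choose) else 1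
  have hJ : ∀ x y, y < x → (∀ z ∈ s, y < z → x ≤ z) → J x = 1 + (g x - g y) := by
    intro x y hyx hy
    have hex : ∃ y, y < x ∧ ∀ z ∈ s, y < z → x ≤ z := ⟨y, hyx, hy⟩
    obtain ⟨h1, h2⟩ := hex.choose_spec
    simp only [J, dif_pos hex]
    rcases le_total y hex.choose with h | h
    · rw [hg y _ ⟨h, fun z hz hyz => h1.trans_le (hy z hz hyz)⟩]
    · rw [hg _ y ⟨h, fun z hz hyz => hyx.trans_le (h2 z hz hyz)⟩]
  refine ⟨fun t => ∏ x ∈ s.filter (fun x => o < x ∧ x ≤ t), J x, fun t n u hu => ?_⟩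
  suffices H : ∀ i ≤ n, headProd (fun i => g (u i)) i =
      ∏ x ∈ s.filter (fun x => o < x ∧ x ≤ u i), J x by
    rw [H n le_rfl, hu.last]
  intro i
  induction i with
  | zero =>
    intro _
    rw [hu.zero, Finset.filter_false_of_mem fun x _ hx => absurd hx.1 (not_lt.2 hx.2)]
    simp [headProd]
  | succ i ih =>
    intro hi
    rw [headProd_succ, ih (Nat.le_of_succ_le hi)]
    have hgap : ∀ z ∈ s, u i < z → u (i + 1) ≤ z := fun z hz => hu.gap hi hz
    rcases (hu.mono i.le_succ).eq_or_lt with heq | hlt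
    · simp only [Nat.succ_eq_add_one] at heq
      rw [← heq]; simp
    by_cases hmem : u (i + 1) ∈ s
    · have : s.filter (fun x => o < x ∧ x ≤ u (i + 1)) =
          insert (u (i + 1)) (s.filter (fun x => o < x ∧ x ≤ u i)) := by
        ext x
        simp only [Finset.mem_filter, Finset.mem_insert]
        constructor
        · rintro ⟨hx, hox, hxu⟩
          rcases le_or_gt x (u i) with h | h
          · exact Or.inr ⟨hx, hox, h⟩
          · exact Or.inl (hxu.antisymm (hgap x hx h))
        · rintro (rfl | ⟨hx, hox, hxu⟩)
          · exact ⟨hmem, (ho _).trans_lt hlt, le_rfl⟩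
          · exact ⟨hx, hox, hxu.trans hlt.le⟩
      rw [this, Finset.prod_insert (by simp [hlt]), hJ _ _ hlt hgap, mul_comm]
    · have hcell : SameCell s (u i) (u (i + 1)) :=
        ⟨hlt.le, fun z hz hz' => (hgap z hz hz').lt_of_ne fun h => hmem (h ▸ hz)⟩
      have : s.filter (fun x => o < x ∧ x ≤ u (i + 1)) =
          s.filter (fun x => o < x ∧ x ≤ u i) := by
        refine Finset.filter_congr fun x hx => and_congr_right fun _ => ⟨fun h => ?_, fun h =>
          h.trans hlt.le⟩
        by_contra hx'
        exact absurd (hcell.2 x hx (not_le.1 hx')) (not_lt.2 h)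
      rw [this, hg _ _ hcell]
      simp

/-- The total variation of `f` is at most `M`. -/
def VarLE (f : X → ℝ) (M : ℝ) : Prop :=
  ∀ u : ℕ → X, Monotone u → ∀ n, seqVar (fun i => f (u i)) n ≤ M

lemma VarLE.comp_monotone {f : X → ℝ} {M : ℝ} (h : VarLE f M) {ρ : X → X} (hρ : Monotone ρ) :
    VarLE (fun x => f (ρ x)) M :=
  fun _ hu n => h _ (hρ.comp hu) n

lemma VarLE.nonneg {f : X → ℝ} {M : ℝ} (h : VarLE f M) (x : X) : 0 ≤ M :=
  (seqVar_nonneg _ 0).trans (h (fun _ => x) monotone_const 0)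

lemma varLE_of_eVariationOn_le {f : X → ℝ} {M : ℝ≥0} (h : eVariationOn f univ ≤ M) :
    VarLE f M := by
  intro u hu n
  have h1 := (eVariationOn.sum_le (f := f) (n := n) hu fun i => mem_univ (u i)).trans h
  simp_rw [edist_dist] at h1
  rw [← ENNReal.ofReal_sum_of_nonneg fun _ _ => dist_nonneg,
    ← ENNReal.ofReal_coe_nnreal] at h1
  exact (ENNReal.ofReal_le_ofReal_iff M.coe_nonneg).1 h1

lemma VarLE.boundedVariationOn {f : X → ℝ} {M : ℝ} (h : VarLE f M) :
    BoundedVariationOn f univ := by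
  refine ((iSup_le ?_).trans_lt (ENNReal.ofReal_lt_top (r := M))).ne
  rintro ⟨n, u, hu, -⟩
  simp_rw [edist_dist]
  rw [← ENNReal.ofReal_sum_of_nonneg fun _ _ => dist_nonneg]
  exact ENNReal.ofReal_le_ofReal (h u hu n)

/-- The product integral of a regulated function of bounded variation exists. -/
lemma exists_productIntegral (ho : ∀ x, o ≤ x) {A : X → ℝ} {M : ℝ} (hA : Regulated A)
    (hM : VarLE A M) :
    ∃ φ : X → ℝ, ∀ ε : ℝ, 0 < ε → ∃ s : Finset X, ∀ t n u, IsRefined s o t n u →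
      |headProd (fun i => A (u i)) n - φ t| ≤ ε := by
  have hC := lipConst_nonneg (hM.nonneg o)
  refine exists_refinement_limit (F := fun n u => headProd (fun i => A (u i)) n) ho fun ε hε => ?_
  obtain ⟨s, hs⟩ := hA (ε / (2 * (lipConst M + 1))) (by positivity)
  -- `A ∘ ρ` is a step function uniformly close to `A`; since `ρ` is monotone its variation is still
  -- at most `M`, so the Lipschitz bound applies to the pair.
  obtain ⟨ρ, hρ, -, hcell, hconst⟩ := exists_cellFloor ho s
  obtain ⟨c, hc⟩ := exists_headProd_eq_of_step ho (g := fun x => A (ρ x))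
    (fun x y hxy => congrArg A (hconst x y hxy))
  refine ⟨s, fun t n u m w hu hw => ?_⟩
  have key : ∀ n u, IsRefined s o t n u → |headProd (fun i => A (u i)) n - c t| ≤ ε / 2 := by
    intro n u hu
    rw [← hc t n u hu]
    refine (abs_headProd_sub_le ((hM.comp_monotone hρ) u hu.mono n) (hM u hu.mono n)
      fun i _ => hs _ _ (hcell (u i))).trans ?_
    rw [mul_div_assoc', div_le_div_iff₀ (by positivity) two_pos]
    nlinarith
  have h1 := key n u hu
  have h2 := key m w hw
  rw [abs_le] at *
  constructor <;> linarith

end Order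

/-! ### Regulated functions: one-sided limits and measurability. -/

section Topology

variable {X : Type*} [LinearOrder X] [TopologicalSpace X] [OrderTopology X]
  {f g F : X → ℝ} {s : Finset X} {o t : X} {n : ℕ} {u : ℕ → X} {ε : ℝ}

/-- A right-continuous function with left limits on a compact order is regulated. -/
lemma regulated_of_cadlag [CompactSpace X] (hr : ∀ x, ContinuousWithinAt f (Ici x) x)
    (hl : ∀ x, ∃ l : ℝ, Tendsto f (𝓝[<] x) (𝓝 l)) : Regulated f := by
  classical
  intro ε hε
  suffices H : ∃ s : Finset X, ∀ y ∈ (univ : Set X), ∀ z, SameCell s y z → |f z - f y| ≤ ε by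
    obtain ⟨s, hs⟩ := H
    exact ⟨s, fun x y => hs x (mem_univ x) y⟩
  refine isCompact_univ.induction_on
    (p := fun S => ∃ s : Finset X, ∀ y ∈ S, ∀ z, SameCell s y z → |f z - f y| ≤ ε)
    ⟨∅, by simp⟩ (fun S T hST ⟨s, hs⟩ => ⟨s, fun y hy => hs y (hST hy)⟩) ?_ fun x _ => ?_
  · rintro S T ⟨s, hs⟩ ⟨s', hs'⟩
    refine ⟨s ∪ s', fun y hy z hyz => ?_⟩
    rcases hy with hy | hy
    · exact hs y hy z (hyz.of_subset Finset.subset_union_left)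
    · exact hs' y hy z (hyz.of_subset Finset.subset_union_right)
  have hclose : ∀ a b l : ℝ, dist a l < ε / 2 → dist b l < ε / 2 → |b - a| ≤ ε := by
    intro a b l ha hb
    have := dist_triangle_right b a l
    rw [Real.dist_eq b a] at this
    linarith
  have hR : ∃ R ∈ 𝓝 x, ∃ s : Finset X, ∀ y ∈ R, x ≤ y → ∀ z, SameCell s y z →
      |f z - f y| ≤ ε := by
    by_cases htop : ∃ r, x < r
    · obtain ⟨r, hr'⟩ := htop
      obtain ⟨r, hxr, hsub⟩ := (mem_nhdsGE_iff_exists_Ico_subset' hr').1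
        ((hr x).eventually (Metric.ball_mem_nhds (f x) (half_pos hε)))
      -- With `r` in the finite set, a cell that starts in `[x, r)` cannot leave it. On the left of
      -- `x`, the point `x` itself plays this role.
      refine ⟨Iio r, Iio_mem_nhds hxr, {r}, fun y hy hxy z hyz => ?_⟩
      exact hclose _ _ (f x) (hsub ⟨hxy, hy⟩)
        (hsub ⟨hxy.trans hyz.1, hyz.2 r (Finset.mem_singleton_self r) hy⟩)
    · have htop : ∀ r, r ≤ x := fun r => not_lt.1 fun h => htop ⟨r, h⟩
      refine ⟨univ, univ_mem, ∅, fun y _ hxy z hyz => ?_⟩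
      rw [(htop y).antisymm hxy, (htop z).antisymm (hxy.trans hyz.1)]
      simpa using hε.le
  have hL : ∃ L ∈ 𝓝 x, ∀ y ∈ L, ∀ z, y ≤ z → z < x → |f z - f y| ≤ ε := by
    by_cases hbot : ∃ r, r < x
    · obtain ⟨r, hr'⟩ := hbot
      obtain ⟨l, hl⟩ := hl x
      obtain ⟨r, hxr, hsub⟩ := (mem_nhdsLT_iff_exists_Ioo_subset' hr').1
        (hl.eventually (Metric.ball_mem_nhds l (half_pos hε)))
      refine ⟨Ioi r, Ioi_mem_nhds hxr, fun y hy z hyz hzx => ?_⟩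
      exact hclose _ _ l (hsub ⟨hy, hyz.trans_lt hzx⟩) (hsub ⟨hy.out.trans_le hyz, hzx⟩)
    · exact ⟨univ, univ_mem, fun y _ z _ hzx => absurd ⟨z, hzx⟩ hbot⟩
  obtain ⟨R, hR, s, hs⟩ := hR
  obtain ⟨L, hL, hL'⟩ := hL
  refine ⟨L ∩ R, mem_nhdsWithin_of_mem_nhds (inter_mem hL hR), insert x s, fun y hy z hyz => ?_⟩
  rcases le_or_gt x y with h | h
  · exact hs y hy.2 h z (hyz.of_subset (Finset.subset_insert _ _))
  · exact hL' y hy.1 z hyz.1 (hyz.2 x (Finset.mem_insert_self _ _) h)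

lemma Regulated.continuousWithinAt (hf : Regulated f) (x : X) :
    ContinuousWithinAt f (Ici x) x := by
  refine Metric.tendsto_nhds.2 fun ε hε => ?_
  obtain ⟨s, hs⟩ := hf (ε / 2) (half_pos hε)
  have h1 : ∀ᶠ z in 𝓝 x, ∀ w ∈ s, x < w → z < w := by
    refine (Filter.eventually_all_finset s).2 fun w _ => ?_
    by_cases hxw : x < w
    · filter_upwards [Iio_mem_nhds hxw] with z hz _ using hz
    · exact Eventually.of_forall fun z h => absurd h hxw
  filter_upwards [mem_nhdsWithin_of_mem_nhds h1, self_mem_nhdsWithin] with z hz hxz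
  rw [Real.dist_eq]
  exact (hs x z ⟨hxz, hz⟩).trans_lt (half_lt_self hε)

lemma Regulated.exists_tendsto (hf : Regulated f) (x : X) :
    ∃ l : ℝ, Tendsto f (𝓝[<] x) (𝓝 l) := by
  rcases (𝓝[<] x).eq_or_neBot with hbot | hne
  · exact ⟨0, by rw [hbot]; exact tendsto_bot⟩
  refine cauchy_map_iff_exists_tendsto.1 (Metric.cauchy_iff.2 ⟨inferInstance, fun ε hε => ?_⟩)
  obtain ⟨s, hs⟩ := hf (ε / 2) (half_pos hε)
  have h1 : ∀ᶠ z in 𝓝 x, ∀ w ∈ s, w < x → w < z := by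
    refine (Filter.eventually_all_finset s).2 fun w _ => ?_
    by_cases hxw : w < x
    · filter_upwards [Ioi_mem_nhds hxw] with z hz _ using hz
    · exact Eventually.of_forall fun z h => absurd h hxw
  refine ⟨_, image_mem_map (inter_mem (mem_nhdsWithin_of_mem_nhds h1) self_mem_nhdsWithin), ?_⟩
  have key : ∀ y z, (∀ w ∈ s, w < x → w < y) → z < x → y ≤ z → |f z - f y| < ε := by
    intro y z hy hz hyz
    refine (hs y z ⟨hyz, fun w hw hyw => ?_⟩).trans_lt (half_lt_self hε)
    by_contra hzw
    exact absurd (hy w hw ((not_lt.1 hzw).trans_lt hz)) hyw.not_gt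
  rintro _ ⟨y, hy, rfl⟩ _ ⟨z, hz, rfl⟩
  rw [Real.dist_eq]
  rcases le_total y z with h | h
  · rw [abs_sub_comm]
    exact key y z hy.1 hz.2 h
  · exact key z y hz.1 hy.2 h

/-- On a cell of a fine partition, the left limit is close to the value at the left end point. -/
lemma IsRefined.abs_leftLim_sub_le [DenselyOrdered X]
    (hF : ∀ x, Tendsto f (𝓝[<] x) (𝓝 (F x)))
    (hs : ∀ x y, SameCell s x y → |f y - f x| ≤ ε) (hu : IsRefined s o t n u) {i : ℕ}
    (hi : i < n) {r : X} (hr : u i < r) (hr' : r ≤ u (i + 1)) : |F r - f (u i)| ≤ ε := by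
  have : (𝓝[<] r).NeBot := nhdsLT_neBot_of_exists_lt ⟨_, hr⟩
  refine le_of_tendsto (((hF r).sub_const _).abs) ?_
  filter_upwards [Ioo_mem_nhdsLT hr] with y hy
  exact hs _ _ (hu.sameCell hi le_rfl hy.1.le (hy.2.trans_le hr'))

/-- If `x` is not in the finite set for a given error, points just to the left of `x` share its
cell, so the jump at `x` is at most that error. Jumps thus occur only on a countable union of finite
sets. -/
lemma Regulated.countable_leftLim_ne (hf : Regulated f)
    (hF : ∀ x, Tendsto f (𝓝[<] x) (𝓝 (F x))) :
    {x | f x ≠ F x ∧ (𝓝[<] x).NeBot}.Countable := by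
  choose s hs using fun k : ℕ => hf (1 / (k + 1 : ℝ)) (by positivity)
  refine (countable_iUnion fun k => (s k).countable_toSet).mono ?_
  rintro x ⟨hx, hne⟩
  by_contra hmem
  simp only [mem_iUnion, Finset.mem_coe, not_exists] at hmem
  have hle : ∀ k : ℕ, |f x - F x| ≤ 1 / (k + 1 : ℝ) := by
    intro k
    have h1 : ∀ᶠ z in 𝓝 x, ∀ w ∈ s k, w < x → w < z := by
      refine (Filter.eventually_all_finset _).2 fun w _ => ?_
      by_cases hxw : w < x
      · filter_upwards [Ioi_mem_nhds hxw] with z hz _ using hz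
      · exact Eventually.of_forall fun z h => absurd h hxw
    refine le_of_tendsto ((tendsto_const_nhds.sub (hF x)).abs) ?_
    filter_upwards [mem_nhdsWithin_of_mem_nhds h1, self_mem_nhdsWithin] with y hy hyx
    refine hs k y x ⟨le_of_lt hyx, fun w hw hyw => ?_⟩
    refine lt_of_le_of_ne (not_lt.1 fun h => ?_) fun h => hmem k (h ▸ hw)
    exact absurd (hy w hw h) hyw.not_gt
  have h0 : |f x - F x| ≤ 0 :=
    ge_of_tendsto' tendsto_one_div_add_atTop_nhds_zero_nat hle
  exact hx (sub_eq_zero.1 (abs_nonpos_iff.1 h0))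

variable [SecondCountableTopology X] [MeasurableSpace X] [BorelSpace X]

/-- `f` is the uniform limit of `f ∘ ρ k` with `ρ k` monotone and of finite range. -/
lemma Regulated.measurable (ho : ∀ x, o ≤ x) (hf : Regulated f) : Measurable f := by
  classical
  choose s hs using fun k : ℕ => hf (1 / (k + 1 : ℝ)) (by positivity)
  choose ρ hρ hmem hcell _ using fun k => exists_cellFloor ho (s k)
  refine measurable_of_tendsto_metrizable (f := fun k x => f (ρ k x)) (fun k => ?_) ?_
  · have h1 : Measurable (fun x => if x = o ∨ x ∈ s k then f x else 0) := by
      refine (measurable_const (a := (0 : ℝ))).measurable_of_countable_ne ?_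
      refine (insert o (s k)).countable_toSet.mono fun x hx => ?_
      simp only [mem_ofPred_eq] at hx
      by_contra h
      simp only [Finset.coe_insert, mem_insert_iff, Finset.mem_coe] at h
      simp [h] at hx
    have h2 := h1.comp (hρ k).measurable
    convert h2 using 1
    ext x
    simp [hmem k x]
  · refine tendsto_pi_nhds.2 fun x => ?_
    rw [tendsto_iff_dist_tendsto_zero]
    refine squeeze_zero (fun _ => dist_nonneg) (fun k => ?_)
      tendsto_one_div_add_atTop_nhds_zero_nat
    rw [Real.dist_eq, abs_sub_comm]
    exact hs k _ _ (hcell k x)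

lemma Regulated.measurable_leftLim [DenselyOrdered X] (ho : ∀ x, o ≤ x) (hf : Regulated f)
    (hF : ∀ x, Tendsto f (𝓝[<] x) (𝓝 (F x))) : Measurable F := by
  refine (hf.measurable ho).measurable_of_countable_ne ?_
  refine ((hf.countable_leftLim_ne hF).union (countable_singleton o)).mono fun x hx => ?_
  rcases (ho x).eq_or_lt with h | h
  · exact Or.inr h.symm
  · exact Or.inl ⟨hx, nhdsLT_neBot_of_exists_lt ⟨_, h⟩⟩

end Topology

/-! ### Riemann–Stieltjes sums and Lebesgue–Stieltjes integrals. -/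

section Integral

lemma isFiniteMeasure_variation {X : Type*} [MeasurableSpace X] (ν : SignedMeasure X) :
    IsFiniteMeasure ν.variation := by
  rw [← SignedMeasure.totalVariation_eq_variation, SignedMeasure.totalVariation]
  infer_instance

/-- The error of a Riemann–Stieltjes sum on a single cell `S`: the constant weight is integrated
exactly, and the remaining integral is dominated by one against the variation measure. -/
lemma abs_mul_sub_setIntegral_le {X : Type*} [MeasurableSpace X] (ν : SignedMeasure X)
    {S : Set X} (hS : MeasurableSet S) {G b : X → ℝ} {c : ℝ}
    (hG : MeasureTheory.Integrable G ν.variation) (hb : MeasureTheory.Integrable b ν.variation)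
    (h : ∀ r ∈ S, |c - G r| ≤ b r) :
    |c * ν S - ∫ᵛ r in S, G r ∂•ν| ≤ ∫ r in S, b r ∂ν.variation := by
  have := isFiniteMeasure_variation ν
  have h1 : c * ν S = ∫ᵛ _ in S, c ∂•ν := by
    rw [VectorMeasure.integral_const, VectorMeasure.restrict_apply _ hS MeasurableSet.univ,
      univ_inter]
    rfl
  rw [h1, ← VectorMeasure.integral_fun_sub (integrable_const c)
    (VectorMeasure.Integrable.restrict hG)]
  refine (VectorMeasure.norm_integral_le_integral_norm (μ := ν.restrict S)
    (f := fun r => c - G r) (B := ContinuousLinearMap.lsmul ℝ ℝ)).trans ?_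
  rw [VectorMeasure.variation_restrict hS]
  have hint : MeasureTheory.Integrable (fun r => ‖c - G r‖) (ν.variation.restrict S) :=
    ((integrable_const c).sub hG.restrict).norm
  calc _ ≤ 1 * ∫ r in S, ‖c - G r‖ ∂ν.variation :=
        mul_le_mul_of_nonneg_right ContinuousLinearMap.opNorm_lsmul_le
          (integral_nonneg fun _ => norm_nonneg _)
    _ ≤ _ := by
        rw [one_mul]
        exact setIntegral_mono_on hint hb.restrict hS h

variable {X : Type*} [LinearOrder X] [TopologicalSpace X] [OrderTopology X] [DenselyOrdered X]
  [SecondCountableTopology X] [MeasurableSpace X] [BorelSpace X]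

/-- A finite measure gives little mass to short intervals to the left of a point. -/
lemma exists_measure_Ioo_lt {o : X} (ho : ∀ x, o ≤ x) (μ : Measure X) [IsFiniteMeasure μ] (c : X)
    {η : ℝ} (hη : 0 < η) : ∃ c' ≤ c, (o < c → c' < c) ∧ μ.real (Ioo c' c) < η := by
  rcases (ho c).eq_or_lt with rfl | hoc
  · exact ⟨o, le_rfl, fun h => h, by simpa using hη⟩
  obtain ⟨w, hw, hmem, hlim⟩ := exists_seq_strictMono_tendsto' hoc
  -- The intervals exclude `c`, so an atom of `μ` at `c` does no harm.
  have h0 : ⋂ k, Ioo (w k) c = ∅ := by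
    refine eq_empty_of_forall_notMem fun x hx => ?_
    simp only [mem_iInter, mem_Ioo] at hx
    exact absurd (le_of_tendsto' hlim fun k => (hx k).1.le) (not_le.2 (hx 0).2)
  have h1 := tendsto_measure_iInter_atTop (μ := μ) (s := fun k => Ioo (w k) c)
    (fun _ => measurableSet_Ioo.nullMeasurableSet)
    (fun i j hij => Ioo_subset_Ioo_left (hw.monotone hij)) ⟨0, measure_ne_top _ _⟩
  rw [h0, measure_empty] at h1
  obtain ⟨k, hk⟩ := (h1.eventually (gt_mem_nhds (ENNReal.ofReal_pos.2 hη))).exists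
  exact ⟨w k, (hmem k).2.le, fun _ => (hmem k).2,
    (ENNReal.toReal_lt_of_lt_ofReal hk)⟩

/-- Lebesgue–Stieltjes integrals of products of a left-continuous and a right-continuous regulated
function are limits of Riemann–Stieltjes sums. -/
theorem exists_rsSum_sub_integral_le [CompactIccSpace X] {o : X} (ho : ∀ x, o ≤ x) {f F g h : X → ℝ} {K : ℝ}
    (hf : Regulated f) (hF : ∀ x, Tendsto f (𝓝[<] x) (𝓝 (F x))) (hg : Regulated g)
    (hfK : ∀ x, |f x| ≤ K) (hFK : ∀ x, |F x| ≤ K) (hgK : ∀ x, |g x| ≤ K)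
    (hh : Regulated h) (hv : BoundedVariationOn h univ) {ε : ℝ} (hε : 0 < ε) :
    ∃ s : Finset X, ∀ t n u, IsRefined s o t n u →
      |rsSum (fun i => f (u i)) (fun i => g (u i)) (fun i => h (u i)) n
        - ∫ᵛ r in Ioc o t, F r * g r ∂•hv.vectorMeasure| ≤ ε := by
  classical
  have hK : 0 ≤ K := (abs_nonneg _).trans (hfK o)
  set ν := hv.vectorMeasure with hν
  set μ := ν.variation with hμ
  have hfin : IsFiniteMeasure μ := isFiniteMeasure_variation ν
  have hνIoc : ∀ x y, x ≤ y → ν (Ioc x y) = h y - h x := fun x y hxy => by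
    rw [hν, hv.vectorMeasure_Ioc hxy, (hh.continuousWithinAt x).rightLim_eq,
      (hh.continuousWithinAt y).rightLim_eq]
  obtain ⟨κ, hκ, hκε⟩ : ∃ κ : ℝ, 0 < κ ∧ 2 * K * κ * μ.real univ ≤ ε / 2 := by
    refine ⟨ε / 2 / (2 * K * μ.real univ + 1), by positivity, ?_⟩
    have hm : 0 ≤ 2 * K * μ.real univ := by positivity
    rw [show 2 * K * (ε / 2 / (2 * K * μ.real univ + 1)) * μ.real univ
      = ε / 2 * (2 * K * μ.real univ) / (2 * K * μ.real univ + 1) by ring,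
      div_le_iff₀ (by positivity)]
    nlinarith
  obtain ⟨s₁, hs₁⟩ := hf κ hκ
  obtain ⟨s₂, hs₂⟩ := hg κ hκ
  obtain ⟨η, hη, hηε⟩ : ∃ η : ℝ, 0 < η ∧ 2 * K ^ 2 * (s₂.card * η) ≤ ε / 2 := by
    refine ⟨ε / 2 / (2 * K ^ 2 * s₂.card + 1), by positivity, ?_⟩
    have hm : 0 ≤ 2 * K ^ 2 * (s₂.card : ℝ) := by positivity
    rw [show 2 * K ^ 2 * (s₂.card * (ε / 2 / (2 * K ^ 2 * s₂.card + 1)))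
      = ε / 2 * (2 * K ^ 2 * s₂.card) / (2 * K ^ 2 * s₂.card + 1) by ring,
      div_le_iff₀ (by positivity)]
    nlinarith
  -- Evaluating `g` at the right end of a cell is inaccurate only when that end is a point `c ∈ s₂`,
  -- where `g` may jump. Adding `p c` to the partition confines the inaccuracy to `(p c, c)`, of
  -- measure less than `η`.
  choose p hp hp' hpμ using fun c => exists_measure_Ioo_lt ho μ c hη
  set B : Set X := ⋃ c ∈ s₂, Ioo (p c) c with hB
  have hBmeas : MeasurableSet B := s₂.measurableSet_biUnion fun c _ => measurableSet_Ioo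
  have hBμ : μ.real B ≤ s₂.card * η := by
    refine (measureReal_biUnion_finset_le s₂ _).trans ?_
    calc ∑ c ∈ s₂, μ.real (Ioo (p c) c) ≤ ∑ c ∈ s₂, η := Finset.sum_le_sum fun c _ => (hpμ c).le
      _ = _ := by rw [Finset.sum_const, nsmul_eq_mul]
  -- Pointwise error bound: `K * κ` from each weight, and additionally `K * (2 * K)` on the bad set
  -- `B`.
  set b : X → ℝ := fun r => 2 * K * κ + B.indicator (fun _ => 2 * K ^ 2) r with hb
  have hb0 : ∀ r, 0 ≤ b r := fun r => by
    have : 0 ≤ B.indicator (fun _ => 2 * K ^ 2) r := indicator_nonneg (fun _ _ => by positivity) r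
    have : 0 ≤ 2 * K * κ := by positivity
    simp only [hb]
    linarith
  have hbint : MeasureTheory.Integrable b μ :=
    (integrable_const _).add ((integrable_const _).indicator hBmeas)
  have hGint : MeasureTheory.Integrable (fun r => F r * g r) μ := by
    refine Integrable.of_bound
      ((hf.measurable_leftLim ho hF).mul (hg.measurable ho)).aestronglyMeasurable (K * K)
      (Eventually.of_forall fun r => ?_)
    rw [Real.norm_eq_abs, abs_mul]
    exact mul_le_mul (hFK r) (hgK r) (abs_nonneg _) hK
  refine ⟨s₁ ∪ (s₂ ∪ s₂.image p), fun t n u hu => ?_⟩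
  have hu₁ : IsRefined s₁ o t n u := hu.of_subset Finset.subset_union_left
  have hu₂ : IsRefined s₂ o t n u :=
    hu.of_subset (Finset.subset_union_left.trans Finset.subset_union_right)
  have hpt : ∀ i < n, ∀ r ∈ Ioc (u i) (u (i + 1)),
      |f (u i) * g (u (i + 1)) - F r * g r| ≤ b r := by
    intro i hi r hr
    have hF' := hu₁.abs_leftLim_sub_le hF hs₁ hi hr.1 hr.2
    have hg' : |g (u (i + 1)) - g r| ≤ κ + B.indicator (fun _ => 2 * K) r := by
      by_cases hrB : r ∈ B
      · rw [indicator_of_mem hrB]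
        have h1 := hgK (u (i + 1))
        have h2 := hgK r
        rw [abs_le] at *
        constructor <;> linarith
      · rw [indicator_of_notMem hrB, add_zero]
        refine hs₂ _ _ ⟨hr.2, fun z hz hrz => ?_⟩
        refine lt_of_le_of_ne (hu₂.gap hi hz (hr.1.trans hrz)) fun heq => hrB ?_
        have hoz : o < z := (ho r).trans_lt hrz
        have hpz : p z ≤ u i := by
          by_contra hlt
          have h3 := hu.gap hi (z := p z) (by simp only [Finset.mem_union, Finset.mem_image]
                                              exact Or.inr (Or.inr ⟨z, hz, rfl⟩)) (not_le.1 hlt)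
          exact absurd (hp' z hoz) (not_lt.2 (heq ▸ h3))
        exact mem_biUnion hz ⟨hpz.trans_lt hr.1, hrz⟩
    rw [show f (u i) * g (u (i + 1)) - F r * g r
      = f (u i) * (g (u (i + 1)) - g r) + (f (u i) - F r) * g r by ring]
    refine (abs_add_le _ _).trans ?_
    rw [abs_mul, abs_mul, abs_sub_comm (f (u i))]
    have h1 : |f (u i)| * |g (u (i + 1)) - g r| ≤ K * (κ + B.indicator (fun _ => 2 * K) r) :=
      mul_le_mul (hfK _) hg' (abs_nonneg _) hK
    have h2 : |F r - f (u i)| * |g r| ≤ κ * K :=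
      mul_le_mul hF' (hgK _) (abs_nonneg _) hκ.le
    have h3 : K * B.indicator (fun _ => 2 * K) r = B.indicator (fun _ => 2 * K ^ 2) r := by
      by_cases hrB : r ∈ B
      · simp only [indicator_of_mem hrB]; ring
      · simp only [indicator_of_notMem hrB, mul_zero]
    simp only [hb]
    linarith
  have main : ∀ i ≤ n, |rsSum (fun i => f (u i)) (fun i => g (u i)) (fun i => h (u i)) i
      - ∫ᵛ r in Ioc o (u i), F r * g r ∂•ν| ≤ ∫ r in Ioc o (u i), b r ∂μ := by
    intro i
    induction i with
    | zero => intro _; simp [hu.zero, rsSum]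
    | succ i ih =>
      intro hi
      have hlt : i < n := hi
      have hle : u i ≤ u (i + 1) := hu.mono i.le_succ
      have hsplit : Ioc o (u (i + 1)) = Ioc o (u i) ∪ Ioc (u i) (u (i + 1)) :=
        (Ioc_union_Ioc_eq_Ioc (ho _) hle).symm
      have hdisj : Disjoint (Ioc o (u i)) (Ioc (u i) (u (i + 1))) :=
        Ioc_disjoint_Ioc_of_le le_rfl
      have h1 := ih hlt.le
      have h2 := abs_mul_sub_setIntegral_le ν measurableSet_Ioc hGint hbint (hpt i hlt)
      rw [hνIoc _ _ hle] at h2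
      rw [rsSum_succ, hsplit, VectorMeasure.setIntegral_union hdisj measurableSet_Ioc
        measurableSet_Ioc (VectorMeasure.Integrable.restrict hGint)
        (VectorMeasure.Integrable.restrict hGint),
        setIntegral_union hdisj measurableSet_Ioc hbint.integrableOn hbint.integrableOn]
      rw [abs_le] at *
      constructor <;> linarith
  have h1 := main n le_rfl
  rw [hu.last] at h1
  refine h1.trans ?_
  calc ∫ r in Ioc o t, b r ∂μ ≤ ∫ r, b r ∂μ :=
        setIntegral_le_integral hbint (Eventually.of_forall hb0)
    _ = 2 * K * κ * μ.real univ + 2 * K ^ 2 * μ.real B := by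
        rw [integral_add (integrable_const _) ((integrable_const _).indicator hBmeas),
          integral_const, integral_indicator hBmeas, setIntegral_const, smul_eq_mul, smul_eq_mul]
        ring
    _ ≤ ε := by
        have : 2 * K ^ 2 * μ.real B ≤ 2 * K ^ 2 * (s₂.card * η) := by gcongr
        linarith

end Integral

/-! ### Limits of products and of Riemann–Stieltjes sums. -/

section ProductIntegral

variable {X : Type*} [LinearOrder X] {s : Finset X} {o t : X} {n : ℕ} {u : ℕ → X}
  {A B φ χ f g : X → ℝ} {M K L c : ℝ}

/-- `φ t` is the product integral of `A` over `(o, t]`, uniformly in `t`. -/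
def IsProdInt (o : X) (A φ : X → ℝ) : Prop :=
  ∀ ε : ℝ, 0 < ε → ∃ s : Finset X, ∀ t n u, IsRefined s o t n u →
    |headProd (fun i => A (u i)) n - φ t| ≤ ε

/-- `H t` is the limit of the Riemann–Stieltjes sums of `p₋ q` with respect to `D` over
`(o, t]`. -/
def IsRSInt (o : X) (p q D H : X → ℝ) : Prop :=
  ∀ t, ∀ ε : ℝ, 0 < ε → ∃ s : Finset X, ∀ n u, IsRefined s o t n u →
    |rsSum (fun i => p (u i)) (fun i => q (u i)) (fun i => D (u i)) n - H t| ≤ ε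

lemma VarLE.of_dominated {v : X → ℝ} (hf : ∀ x y, x ≤ y → |f y - f x| ≤ v y - v x)
    (h0 : ∀ x, 0 ≤ v x) (hM : ∀ x, v x ≤ M) : VarLE f M := by
  intro u hu n
  calc seqVar (fun i => f (u i)) n ≤ ∑ i ∈ Finset.range n, (v (u (i + 1)) - v (u i)) :=
        Finset.sum_le_sum fun i _ => hf _ _ (hu i.le_succ)
    _ = v (u n) - v (u 0) := Finset.sum_range_sub (fun i => v (u i)) n
    _ ≤ M := by linarith [h0 (u 0), hM (u n)]

lemma BoundedVariationOn.exists_dominating (ho : ∀ x, o ≤ x) (hA : BoundedVariationOn A univ) :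
    ∃ (v : X → ℝ) (V : ℝ), (∀ x y, x ≤ y → |A y - A x| ≤ v y - v x) ∧ (∀ x, 0 ≤ v x) ∧
      ∀ x, v x ≤ V :=
  ⟨variationOnFromTo A univ o, (eVariationOn A univ).toReal, fun x y hxy =>
    variationOnFromTo.abs_sub_le_sub_of_le hA.locallyBoundedVariationOn (mem_univ o) (mem_univ x)
      (mem_univ y) hxy, fun x => variationOnFromTo.nonneg_of_le A univ (ho x), fun _ =>
    (le_abs_self _).trans (variationOnFromTo.abs_le_eVariationOn hA)⟩

/-- Composing `f` with the cell floor changes its value only across points of `s`, by at most `2 *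
K`; the variation is dominated by the counting function of `s`. No bound on the variation of `f` is
needed. -/
lemma Regulated.exists_step (ho : ∀ x, o ≤ x) (hf : Regulated f) (hK : ∀ x, |f x| ≤ K) {ε : ℝ}
    (hε : 0 < ε) : ∃ (β : X → ℝ) (V : ℝ), (∀ x, |f x - β x| ≤ ε) ∧ VarLE β V := by
  classical
  obtain ⟨s, hs⟩ := hf ε hε
  obtain ⟨ρ, -, -, hcell, hconst⟩ := exists_cellFloor ho s
  have hK0 : 0 ≤ K := (abs_nonneg _).trans (hK o)
  refine ⟨fun x => f (ρ x), 2 * K * s.card, fun x => hs _ _ (hcell x),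
    VarLE.of_dominated (v := fun x => 2 * K * (s.filter (· ≤ x)).card) (fun x y hxy => ?_)
      (fun x => by positivity) fun x => ?_⟩
  · have hsub : s.filter (· ≤ x) ⊆ s.filter (· ≤ y) :=
      Finset.monotone_filter_right s fun z _ hz => hz.trans hxy
    by_cases h : SameCell s x y
    · rw [hconst x y h, sub_self, abs_zero, sub_nonneg]
      gcongr
    · have hex : ∃ z ∈ s, x < z ∧ z ≤ y := by
        by_contra hne
        push Not at hne
        exact h ⟨hxy, hne⟩
      obtain ⟨z, hz, hxz, hzy⟩ := hex
      have hlt : (s.filter (· ≤ x)).card < (s.filter (· ≤ y)).card :=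
        Finset.card_lt_card ⟨hsub, fun hsub' => by
          have := hsub' (Finset.mem_filter.2 ⟨hz, hzy⟩)
          exact absurd (Finset.mem_filter.1 this).2 (not_le.2 hxz)⟩
      have hlt' : ((s.filter (· ≤ x)).card : ℝ) + 1 ≤ (s.filter (· ≤ y)).card := by
        exact_mod_cast hlt
      have h1 := hK (ρ x)
      have h2 := hK (ρ y)
      have h3 : |f (ρ y) - f (ρ x)| ≤ 2 * K := by
        rw [abs_le] at *
        constructor <;> linarith
      nlinarith
  · have : ((s.filter (· ≤ x)).card : ℝ) ≤ s.card := by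
      exact_mod_cast Finset.card_filter_le _ _
    gcongr

/-- A function controlled by a regulated function is regulated. -/
lemma Regulated.of_controlled {C : ℝ} (hC : 0 ≤ C) (hf : Regulated f)
    (h : ∀ x y η, x ≤ y → 0 ≤ η → (∀ r, x ≤ r → r ≤ y → |f r - f x| ≤ η) →
      |g y - g x| ≤ C * η) : Regulated g := by
  intro ε hε
  obtain ⟨s, hs⟩ := hf (ε / (C + 1)) (by positivity)
  refine ⟨s, fun x y hxy => ?_⟩
  refine (h x y (ε / (C + 1)) hxy.1 (by positivity) fun r hxr hry =>
    hs x r (hxy.mid hxr hry)).trans ?_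
  rw [mul_div_assoc', div_le_iff₀ (by positivity)]
  nlinarith

lemma exists_isRefined_through (ho : ∀ x, o ≤ x) (s : Finset X) {x y : X} (hxy : x ≤ y) :
    ∃ n u, ∃ k ≤ n, u k = x ∧ IsRefined s o y n u ∧ IsRefined s o x k u := by
  classical
  obtain ⟨n, u, hu⟩ := exists_isRefined ho (insert x s) y
  obtain ⟨k, hk, hkx⟩ := hu.mem x (Finset.mem_insert_self _ _) hxy
  have hu' := hu.of_subset (Finset.subset_insert x s)
  exact ⟨n, u, k, hk, hkx, hu', hkx ▸ hu'.restrict hk⟩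

/-- The device for passing discrete inequalities to the limit; the term `C * ε` absorbs errors
proportional to the accuracy of the partition. -/
lemma le_of_forall_near {a b C : ℝ} (h : ∀ ε : ℝ, 0 < ε → ∃ a', |a' - a| ≤ ε ∧ a' ≤ b + C * ε) :
    a ≤ b := by
  by_contra hab
  have hab := not_le.1 hab
  set ε := (a - b) / (2 * (|C| + 1)) with hε
  have hpos : 0 < ε := by
    have := sub_pos.2 hab
    positivity
  obtain ⟨a', h1, h2⟩ := h ε hpos
  have h3 : ε * (2 * (|C| + 1)) = a - b := by
    rw [hε]; field_simp
  have h4 : C * ε ≤ |C| * ε := mul_le_mul_of_nonneg_right (le_abs_self C) hpos.le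
  have h5 := (abs_le.1 h1).1
  nlinarith [abs_nonneg C]

lemma IsProdInt.abs_le (ho : ∀ x, o ≤ x) (h : IsProdInt o A φ) (hM : VarLE A M) (t : X) :
    |φ t| ≤ Real.exp M := by
  refine le_of_forall_near (C := 0) fun ε hε => ?_
  obtain ⟨s, hs⟩ := h ε hε
  obtain ⟨n, u, hu⟩ := exists_isRefined ho s t
  refine ⟨|headProd (fun i => A (u i)) n|, (abs_abs_sub_abs_le _ _).trans (hs t n u hu), ?_⟩
  simpa using abs_headProd_le (hM u hu.mono n) le_rfl

/-- A partition of `[o, y]` through `x` computes both values at once, and the stopped-path estimate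
bounds their difference. This is how `φ` inherits the càdlàg property from `A`. -/
lemma IsProdInt.abs_sub_le_of_osc (ho : ∀ x, o ≤ x) (hA : IsProdInt o A φ) (hAM : VarLE A M)
    {x y : X} {η : ℝ} (hxy : x ≤ y) (hη : 0 ≤ η) (h : ∀ r, x ≤ r → r ≤ y → |A r - A x| ≤ η) :
    |φ y - φ x| ≤ lipConst M * η := by
  refine le_of_forall_near (C := 0) fun ε hε => ?_
  obtain ⟨s, hs⟩ := hA (ε / 2) (half_pos hε)
  obtain ⟨n, u, k, hk, hkx, hu, hu'⟩ := exists_isRefined_through ho s hxy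
  have h1 := hs y n u hu
  have h2 := hs x k u hu'
  refine ⟨|headProd (fun i => A (u i)) n - headProd (fun i => A (u i)) k|,
    (abs_abs_sub_abs_le _ _).trans ?_, ?_⟩
  · rw [_root_.abs_le] at *
    constructor <;> linarith
  · rw [zero_mul, add_zero]
    refine abs_headProd_sub_headProd_le hk (hAM u hu.mono n) hη fun i hki hin => ?_
    simp only [hkx]
    exact h _ (hkx ▸ hu.mono hki) (hu.last ▸ hu.mono hin)

lemma IsProdInt.regulated (ho : ∀ x, o ≤ x) (hA : IsProdInt o A φ) (hAM : VarLE A M)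
    (hreg : Regulated A) : Regulated φ :=
  hreg.of_controlled (lipConst_nonneg (hAM.nonneg o)) fun _ _ _ hxy hη h =>
    hA.abs_sub_le_of_osc ho hAM hxy hη h

lemma IsProdInt.exists_varLE (ho : ∀ x, o ≤ x) (hA : IsProdInt o A φ) (hAM : VarLE A M) :
    ∃ L, VarLE φ L := by
  obtain ⟨v, V, hv, hv0, hV⟩ := hAM.boundedVariationOn.exists_dominating ho
  refine ⟨Real.exp M * V, VarLE.of_dominated (v := fun x => Real.exp M * v x) (fun x y hxy => ?_)
    (fun x => mul_nonneg (Real.exp_pos _).le (hv0 x))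
    fun x => mul_le_mul_of_nonneg_left (hV x) (Real.exp_pos _).le⟩
  rw [← mul_sub]
  refine le_of_forall_near (C := 0) fun ε hε => ?_
  obtain ⟨s, hs⟩ := hA (ε / 2) (half_pos hε)
  obtain ⟨n, u, k, hk, hkx, hu, hu'⟩ := exists_isRefined_through ho s hxy
  have h1 := hs y n u hu
  have h2 := hs x k u hu'
  refine ⟨|headProd (fun i => A (u i)) n - headProd (fun i => A (u i)) k|,
    (abs_abs_sub_abs_le _ _).trans ?_, ?_⟩
  · rw [_root_.abs_le] at *
    constructor <;> linarith
  · have := abs_headProd_sub_headProd_le_var (v := fun i => v (u i)) hk (hAM u hu.mono n)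
      fun i => hv _ _ (hu.mono i.le_succ)
    simpa [hkx, hu.last] using this

/-- A single increment over a fine cell is the jump at its right end plus a small error, so the jump
condition keeps all factors of a fine product away from zero. -/
lemma IsProdInt.exists_pos_le [TopologicalSpace X] [OrderTopology X] [DenselyOrdered X]
    (ho : ∀ x, o ≤ x) (hA : IsProdInt o A φ) (hAM : VarLE A M) (hreg : Regulated A) {F : X → ℝ}
    (hF : ∀ x, Tendsto A (𝓝[<] x) (𝓝 (F x))) {δ : ℝ} (hδ : 0 < δ)
    (hjump : ∀ x, -1 + δ ≤ A x - F x) : ∃ c : ℝ, 0 < c ∧ ∀ t, c ≤ φ t := by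
  classical
  -- Half of `δ` is given up to the oscillation before the jump; the cap `1` covers repeated
  -- partition points, whose factor is `1`.
  set d := min δ 1 / 2 with hd
  have hd0 : 0 < d := half_pos (lt_min hδ one_pos)
  have hdδ : 2 * d ≤ δ := by
    have := min_le_left δ 1
    rw [hd]; linarith
  have hd1 : 2 * d ≤ 1 := by
    have := min_le_right δ 1
    rw [hd]; linarith
  refine ⟨Real.exp (-(M / d)), Real.exp_pos _, fun t => ?_⟩
  obtain ⟨s', hs'⟩ := hreg d hd0
  refine le_of_forall_pos_le_add fun ε hε => ?_
  obtain ⟨s, hs⟩ := hA ε hε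
  obtain ⟨n, u, hu⟩ := exists_isRefined ho (s ∪ s') t
  have h1 := hs t n u (hu.of_subset Finset.subset_union_left)
  have hu' := hu.of_subset (Finset.subset_union_right (s₁ := s) (s₂ := s'))
  have h2 : Real.exp (-(M / d)) ≤ headProd (fun i => A (u i)) n := by
    refine exp_neg_le_headProd hd0 (hAM u hu.mono n) fun i hi => ?_
    rcases (hu.mono i.le_succ).eq_or_lt with heq | hlt
    · simp only [Nat.succ_eq_add_one] at heq
      simp only [← heq]
      linarith
    · have h3 := (abs_le'.1 (hu'.abs_leftLim_sub_le hF hs' hi hlt le_rfl)).2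
      have h4 := hjump (u (i + 1))
      simp only [Nat.succ_eq_add_one] at h3
      linarith
  linarith [(abs_le'.1 h1).1]

lemma IsRSInt.unique (ho : ∀ x, o ≤ x) {p q D H H' : X → ℝ} (h : IsRSInt o p q D H)
    (h' : IsRSInt o p q D H') (t : X) : H t = H' t := by
  classical
  refine sub_eq_zero.1 (abs_nonpos_iff.1 (le_of_forall_pos_le_add fun ε hε => ?_))
  obtain ⟨s, hs⟩ := h t (ε / 2) (half_pos hε)
  obtain ⟨s', hs'⟩ := h' t (ε / 2) (half_pos hε)
  obtain ⟨n, u, hu⟩ := exists_isRefined ho (s ∪ s') t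
  have h1 := hs n u (hu.of_subset Finset.subset_union_left)
  have h2 := hs' n u (hu.of_subset Finset.subset_union_right)
  rw [abs_le] at *
  constructor <;> linarith

lemma IsRSInt.add {p q D E H I : X → ℝ} (h : IsRSInt o p q D H) (h' : IsRSInt o p q E I) :
    IsRSInt o p q (fun x => D x + E x) (fun x => H x + I x) := by
  classical
  intro t ε hε
  obtain ⟨s, hs⟩ := h t (ε / 2) (half_pos hε)
  obtain ⟨s', hs'⟩ := h' t (ε / 2) (half_pos hε)
  refine ⟨s ∪ s', fun n u hu => ?_⟩
  have h1 := hs n u (hu.of_subset Finset.subset_union_left)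
  have h2 := hs' n u (hu.of_subset Finset.subset_union_right)
  have h3 : rsSum (fun i => p (u i)) (fun i => q (u i)) (fun i => D (u i) + E (u i)) n =
      rsSum (fun i => p (u i)) (fun i => q (u i)) (fun i => D (u i)) n +
      rsSum (fun i => p (u i)) (fun i => q (u i)) (fun i => E (u i)) n := by
    rw [rsSum, rsSum, rsSum, ← Finset.sum_add_distrib]
    exact Finset.sum_congr rfl fun i _ => by ring
  rw [h3]
  rw [abs_le] at *
  constructor <;> linarith

lemma rsSum_const_mul (p q D : ℕ → ℝ) (c : ℝ) (n : ℕ) :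
    rsSum p q (fun i => c * D i) n = c * rsSum p q D n := by
  rw [rsSum, rsSum, Finset.mul_sum]
  exact Finset.sum_congr rfl fun i _ => by ring

lemma rsSum_mid_const_mul (p q D : ℕ → ℝ) (c : ℝ) (n : ℕ) :
    rsSum p (fun i => c * q i) D n = c * rsSum p q D n := by
  rw [rsSum, rsSum, Finset.mul_sum]
  exact Finset.sum_congr rfl fun i _ => by ring

lemma IsRSInt.const_mul {p q D H : X → ℝ} (h : IsRSInt o p q D H) (c : ℝ) :
    IsRSInt o p q (fun x => c * D x) (fun x => c * H x) := by
  intro t ε hε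
  obtain ⟨s, hs⟩ := h t (ε / (|c| + 1)) (by positivity)
  refine ⟨s, fun n u hu => ?_⟩
  rw [rsSum_const_mul, ← mul_sub, abs_mul]
  have h1 := hs n u hu
  rw [le_div_iff₀ (by positivity)] at h1
  nlinarith [abs_nonneg (rsSum (fun i => p (u i)) (fun i => q (u i)) (fun i => D (u i)) n - H t)]

lemma IsRSInt.abs_le (ho : ∀ x, o ≤ x) {p q D H : X → ℝ} (h : IsRSInt o p q D H)
    (hp : ∀ x, |p x| ≤ K) (hq : ∀ x, |q x| ≤ K) (hpv : VarLE p L) (hqv : VarLE q L) {η : ℝ}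
    (hD : ∀ x, |D x| ≤ η) (t : X) : |H t| ≤ 2 * K * (K + L) * η := by
  refine le_of_forall_near (C := 0) fun ε hε => ?_
  obtain ⟨s, hs⟩ := h t ε hε
  obtain ⟨n, u, hu⟩ := exists_isRefined ho s t
  refine ⟨_, (abs_abs_sub_abs_le _ _).trans (hs n u hu), ?_⟩
  rw [zero_mul, add_zero]
  exact abs_rsSum_le (fun i _ => hp _) (fun i _ => hq _) (hpv u hu.mono n) (hqv u hu.mono n)
    fun i _ => hD _

lemma IsRSInt.regulated (ho : ∀ x, o ≤ x) {p q D H : X → ℝ} (h : IsRSInt o p q D H)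
    (hp : ∀ x, |p x| ≤ K) (hq : ∀ x, |q x| ≤ K) (hpv : VarLE p L) (hqv : VarLE q L)
    (hD : Regulated D) : Regulated H := by
  classical
  have hK : 0 ≤ K := (abs_nonneg _).trans (hp o)
  have hL : 0 ≤ L := hpv.nonneg o
  refine hD.of_controlled (C := 2 * K * (K + L)) (by positivity) fun x y η hxy hη hosc => ?_
  refine le_of_forall_near (C := 0) fun ε hε => ?_
  obtain ⟨s, hs⟩ := h x (ε / 2) (half_pos hε)
  obtain ⟨s', hs'⟩ := h y (ε / 2) (half_pos hε)
  obtain ⟨n, u, k, hk, hkx, hu, hu'⟩ := exists_isRefined_through ho (s ∪ s') hxy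
  have h1 := hs k u (hu'.of_subset Finset.subset_union_left)
  have h2 := hs' n u (hu.of_subset Finset.subset_union_right)
  refine ⟨|rsSum (fun i => p (u i)) (fun i => q (u i)) (fun i => D (u i)) n
    - rsSum (fun i => p (u i)) (fun i => q (u i)) (fun i => D (u i)) k|,
    (abs_abs_sub_abs_le _ _).trans ?_, ?_⟩
  · rw [_root_.abs_le] at *
    constructor <;> linarith
  · rw [zero_mul, add_zero]
    refine abs_rsSum_sub_rsSum_le hk (fun i _ => hp _) (fun i _ => hq _) (hpv u hu.mono n)
      (hqv u hu.mono n) hη fun i hki hin => ?_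
    simp only [hkx]
    exact hosc _ (hkx ▸ hu.mono hki) (hu.last ▸ hu.mono hin)

lemma VarLE.inv {U : X → ℝ} (hc : 0 < c) (hU : ∀ x, c ≤ U x) (hv : VarLE U L) :
    VarLE (fun x => (U x)⁻¹) (L / c ^ 2) := by
  intro u hu n
  refine le_trans ?_ (div_le_div_of_nonneg_right (hv u hu n) (by positivity))
  rw [seqVar, seqVar, Finset.sum_div]
  refine Finset.sum_le_sum fun i _ => ?_
  have h1 := hU (u i)
  have h2 := hU (u (i + 1))
  have h3 : 0 < U (u i) := hc.trans_le h1
  have h4 : 0 < U (u (i + 1)) := hc.trans_le h2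
  rw [show (U (u (i + 1)))⁻¹ - (U (u i))⁻¹ = -(U (u (i + 1)) - U (u i)) / (U (u (i + 1)) * U (u i))
    by field_simp; ring, abs_div, abs_neg, abs_of_pos (mul_pos h4 h3)]
  refine div_le_div_of_nonneg_left (abs_nonneg _) (by positivity) ?_
  rw [sq]
  exact mul_le_mul h2 h1 hc.le h4.le

end ProductIntegral

/-! ### The difference quotient against the derivative. -/

section Hadamard

/-- The counterpart of `abs_rsSum_le`: for an integrator of bounded variation the weights only need
to be uniformly close, with no control on their variation. -/
lemma abs_rsSum_sub_rsSum_weights_le {p q p' q' D : ℕ → ℝ} {n : ℕ} {a b J K V : ℝ}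
    (hp : ∀ i ≤ n, |p i - p' i| ≤ a) (hq : ∀ i ≤ n, |q i - q' i| ≤ b) (hJ : ∀ i ≤ n, |q i| ≤ J)
    (hK : ∀ i ≤ n, |p' i| ≤ K) (hV : seqVar D n ≤ V) :
    |rsSum p q D n - rsSum p' q' D n| ≤ (a * J + K * b) * V := by
  have ha : 0 ≤ a := (abs_nonneg _).trans (hp 0 n.zero_le)
  have hb : 0 ≤ b := (abs_nonneg _).trans (hq 0 n.zero_le)
  have hJ0 : 0 ≤ J := (abs_nonneg _).trans (hJ 0 n.zero_le)
  have hK0 : 0 ≤ K := (abs_nonneg _).trans (hK 0 n.zero_le)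
  refine le_trans ?_ (mul_le_mul_of_nonneg_left hV (by positivity))
  rw [rsSum, rsSum, ← Finset.sum_sub_distrib, seqVar, Finset.mul_sum]
  refine (Finset.abs_sum_le_sum_abs _ _).trans (Finset.sum_le_sum fun i hi => ?_)
  have hi := Finset.mem_range.1 hi
  rw [← sub_mul, abs_mul]
  refine mul_le_mul_of_nonneg_right ?_ (abs_nonneg _)
  rw [show p i * q (i + 1) - p' i * q' (i + 1)
    = (p i - p' i) * q (i + 1) + p' i * (q (i + 1) - q' (i + 1)) by ring]
  refine (abs_add_le _ _).trans ?_
  rw [abs_mul, abs_mul]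
  exact add_le_add (mul_le_mul (hp i hi.le) (hJ _ hi) (abs_nonneg _) ha)
    (mul_le_mul (hK i hi.le) (hq _ hi) (abs_nonneg _) hK0)

variable {X : Type*} [LinearOrder X] {o : X} {A φ ψ : X → ℝ} {M K L : ℝ}

/-- The quantitative form of the Hadamard differentiability of the product integral: the
difference quotient is compared with the derivative through an approximation `β` of bounded
variation of the direction `α`. -/
theorem exists_hadamard_bound (ho : ∀ x, o ≤ x) (hA : IsProdInt o A φ)
    (hAM : VarLE A M) (hφψ : ∀ x, φ x * ψ x = 1) (hφK : ∀ x, |φ x| ≤ K) (hψK : ∀ x, |ψ x| ≤ K)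
    (hφL : VarLE φ L) (hψL : VarLE ψ L) :
    ∃ C : ℝ, 0 ≤ C ∧ ∀ (α H β : X → ℝ) (V ε : ℝ), IsRSInt o φ ψ α H →
      (∀ x, |α x - β x| ≤ ε) → VarLE β V →
      ∀ (A' φ' B' χ' α' : X → ℝ) (τ ζ η : ℝ), IsProdInt o A' φ' → VarLE A' M →
        IsProdInt o B' χ' → VarLE B' M → τ ≠ 0 → (∀ x, B' x = A' x + τ * α' x) →
        (∀ x, |A' x - A x| ≤ η) → (∀ x, |B' x - A x| ≤ η) → (∀ x, |α' x - α x| ≤ ζ) →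
        ∀ t, |τ⁻¹ * (χ' t - φ' t) - φ t * H t| ≤ C * (ζ + ε) + C * V * η := by
  classical
  have hK : 0 ≤ K := (abs_nonneg _).trans (hφK o)
  have hL : 0 ≤ L := hφL.nonneg o
  have hM : 0 ≤ M := hAM.nonneg o
  have hlip := lipConst_nonneg hM
  have hexp := (Real.exp_pos M).le
  refine ⟨lipConst M + K * (2 * K * (K + L)) + lipConst M * (Real.exp M + K), by positivity, ?_⟩
  intro α H β V ε hH hβ hβV A' φ' B' χ' α' τ ζ η hA' hAM' hB' hBM' hτ hB hAη hBη hαζ t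
  have hε : 0 ≤ ε := (abs_nonneg _).trans (hβ o)
  have hζ : 0 ≤ ζ := (abs_nonneg _).trans (hαζ o)
  have hη : 0 ≤ η := (abs_nonneg _).trans (hAη o)
  have hV : 0 ≤ V := hβV.nonneg o
  refine le_of_forall_near
    (C := (Real.exp M + K * (K * (Real.exp M + 1))) * V) fun κ hκ => ?_
  -- The products of the perturbed paths are needed to a finer accuracy, since their error is
  -- multiplied by `|τ⁻¹|`.
  obtain ⟨κ₁, hκ₁, hκ₁κ⟩ : ∃ κ₁ : ℝ, 0 < κ₁ ∧ |τ⁻¹| * (2 * κ₁) + K * κ₁ ≤ κ := by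
    refine ⟨κ / (|τ⁻¹| * 2 + K + 1), by positivity, ?_⟩
    rw [show |τ⁻¹| * (2 * (κ / (|τ⁻¹| * 2 + K + 1))) + K * (κ / (|τ⁻¹| * 2 + K + 1))
      = κ * (|τ⁻¹| * 2 + K) / (|τ⁻¹| * 2 + K + 1) by ring, div_le_iff₀ (by positivity)]
    nlinarith
  obtain ⟨s₁, hs₁⟩ := hA κ hκ
  obtain ⟨s₂, hs₂⟩ := hA' κ₁ hκ₁
  obtain ⟨s₃, hs₃⟩ := hB' κ₁ hκ₁
  obtain ⟨s₄, hs₄⟩ := hH t κ₁ hκ₁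
  obtain ⟨n, u, hu⟩ := exists_isRefined ho (s₁ ∪ s₂ ∪ (s₃ ∪ s₄)) t
  have hu₁ : IsRefined s₁ o t n u :=
    hu.of_subset (Finset.subset_union_left.trans Finset.subset_union_left)
  have h₂ := hs₂ t n u (hu.of_subset (Finset.subset_union_right.trans Finset.subset_union_left))
  have h₃ := hs₃ t n u (hu.of_subset (Finset.subset_union_left.trans Finset.subset_union_right))
  have h₄ := hs₄ n u (hu.of_subset (Finset.subset_union_right.trans Finset.subset_union_right))
  -- Uniformity in the end point is essential here: an initial segment of a refined partition is
  -- refined for its own end point `u i`.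
  have hhead : ∀ i ≤ n, |headProd (fun i => A (u i)) i - φ (u i)| ≤ κ := fun i hi =>
    hs₁ _ _ _ (hu₁.restrict hi)
  have hvA := hAM u hu.mono n
  have hvA' := hAM' u hu.mono n
  have hvB' := hBM' u hu.mono n
  set a : ℕ → ℝ := fun i => A (u i) with ha
  set a' : ℕ → ℝ := fun i => A' (u i) with ha'
  set b' : ℕ → ℝ := fun i => B' (u i) with hb'
  set p : ℕ → ℝ := headProd b' with hp
  set q : ℕ → ℝ := tailProd a' n with hq
  set p₀ : ℕ → ℝ := fun i => φ (u i) with hp₀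
  set q₀ : ℕ → ℝ := fun i => φ t * ψ (u i) with hq₀
  set x : ℕ → ℝ := fun i => α (u i) with hx
  set x' : ℕ → ℝ := fun i => α' (u i) with hx'
  set y : ℕ → ℝ := fun i => β (u i) with hy
  have hduh : τ⁻¹ * (headProd b' n - headProd a' n) = rsSum p q x' n := by
    rw [headProd_sub_headProd]
    have : (fun i => b' i - a' i) = fun i => τ * x' i := by
      ext i
      simp only [hb', ha', hx', hB]
      ring
    rw [this, rsSum_const_mul, inv_mul_cancel_left₀ hτ]
  have hmid : rsSum p₀ q₀ x n = φ t * rsSum p₀ (fun i => ψ (u i)) x n :=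
    rsSum_mid_const_mul _ _ _ _ _
  have hlast : p₀ n = φ t := by simp only [hp₀, hu.last]
  -- Replacing `α'` by `β` under the discrete weights: these have controlled variation, so only the
  -- sup distance counts.
  have hE1 : |rsSum p q x' n - rsSum p q y n| ≤ lipConst M * (ζ + ε) := by
    rw [← rsSum_sub]
    refine abs_rsSum_prods_le hvA' hvB' fun i _ => ?_
    have h5 := hαζ (u i)
    have h6 := hβ (u i)
    simp only [hx', hy]
    rw [abs_le] at *
    constructor <;> linarith
  -- Replacing the discrete weights by the limiting ones: only here is the variation `V` of `β`
  -- used.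
  have hE2 : |rsSum p q y n - rsSum p₀ q₀ y n| ≤
      ((lipConst M * η + κ) * Real.exp M +
        K * (lipConst M * η + K * ((Real.exp M + 1) * κ))) * V := by
    refine abs_rsSum_sub_rsSum_weights_le (fun i hi => ?_) (fun i hi => ?_)
      (fun i _ => abs_tailProd_le hvA' i) (fun i _ => hφK _) (hβV u hu.mono n)
    · have h5 : |headProd b' i - headProd a i| ≤ lipConst M * η :=
        abs_headProd_sub_le ((seqVar_mono a hi).trans hvA) ((seqVar_mono b' hi).trans hvB')
          fun j _ => hBη _
      exact (abs_sub_le _ (headProd a i) _).trans (add_le_add h5 (hhead i hi))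
    · have h5 : |tailProd a' n i - tailProd a n i| ≤ lipConst M * η :=
        abs_tailProd_sub_le hvA hvA' fun j _ => hAη _
      -- Tail products are recovered from head products by dividing `headProd a i * tailProd a n i =
      -- headProd a n` through `φ (u i)`, with `ψ` as the reciprocal.
      have h6 : tailProd a n i - q₀ i =
          ψ (u i) * (-(tailProd a n i * (headProd a i - p₀ i)) + (headProd a n - p₀ n)) := by
        rw [← headProd_mul_tailProd a hi, hlast]
        simp only [hp₀, hq₀]
        linear_combination (- tailProd a n i) * hφψ (u i)
      have h7 : |tailProd a n i - q₀ i| ≤ K * ((Real.exp M + 1) * κ) := by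
        rw [h6, abs_mul]
        refine mul_le_mul (hψK _) ?_ (abs_nonneg _) hK
        refine (abs_add_le _ _).trans ?_
        rw [abs_neg, abs_mul, add_mul, one_mul]
        exact add_le_add (mul_le_mul (abs_tailProd_le hvA i) (hhead i hi) (abs_nonneg _) hexp)
          (hhead n le_rfl)
      exact (abs_sub_le _ (tailProd a n i) _).trans (add_le_add h5 h7)
  -- Returning from `β` to `α` under the limiting weights, whose variation is at most `L`.
  have hE3 : |rsSum p₀ q₀ y n - rsSum p₀ q₀ x n| ≤ K * (2 * K * (K + L) * ε) := by
    rw [← rsSum_sub, rsSum_mid_const_mul, abs_mul]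
    refine mul_le_mul (hφK t) ?_ (abs_nonneg _) hK
    refine abs_rsSum_le (fun i _ => hφK _) (fun i _ => hψK _) (hφL u hu.mono n)
      (hψL u hu.mono n) fun i _ => ?_
    rw [abs_sub_comm]
    exact hβ _
  refine ⟨|τ⁻¹ * (headProd b' n - headProd a' n) - φ t * rsSum p₀ (fun i => ψ (u i)) x n|,
    (abs_abs_sub_abs_le _ _).trans ?_, ?_⟩
  · rw [show τ⁻¹ * (headProd b' n - headProd a' n) - φ t * rsSum p₀ (fun i => ψ (u i)) x n
        - (τ⁻¹ * (χ' t - φ' t) - φ t * H t)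
      = τ⁻¹ * ((headProd b' n - χ' t) - (headProd a' n - φ' t))
        - φ t * (rsSum p₀ (fun i => ψ (u i)) x n - H t) by ring]
    refine (abs_sub _ _).trans (le_trans ?_ hκ₁κ)
    rw [abs_mul, abs_mul]
    refine add_le_add (mul_le_mul_of_nonneg_left ?_ (abs_nonneg _))
      (mul_le_mul (hφK t) h₄ (abs_nonneg _) hK)
    refine (abs_sub _ _).trans ?_
    linarith
  · rw [hduh, ← hmid]
    have h8 : |rsSum p q x' n - rsSum p₀ q₀ x n| ≤ lipConst M * (ζ + ε) +
        ((lipConst M * η + κ) * Real.exp M +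
        K * (lipConst M * η + K * ((Real.exp M + 1) * κ))) * V + K * (2 * K * (K + L) * ε) := by
      rw [abs_le] at *
      constructor <;> linarith
    refine h8.trans ?_
    have h9 : 0 ≤ lipConst M * (Real.exp M + K) * (ζ + ε) := by positivity
    have h10 : 0 ≤ K * (2 * K * (K + L)) * ζ := by positivity
    have h11 : 0 ≤ (lipConst M + K * (2 * K * (K + L))) * V * η := by positivity
    nlinarith

end Hadamard

/-! ### Stability of regulated functions and of variation bounds. -/

section Closure

variable {X : Type*} [LinearOrder X] {o : X} {f g U : X → ℝ} {J K c : ℝ}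

lemma regulated_const (c : ℝ) : Regulated (fun _ : X => c) :=
  fun ε hε => ⟨∅, fun _ _ _ => by simpa using hε.le⟩

lemma Regulated.mul (hf : Regulated f) (hg : Regulated g) (hJ : 0 ≤ J) (hK : 0 ≤ K)
    (hfJ : ∀ x, |f x| ≤ J) (hgK : ∀ x, |g x| ≤ K) : Regulated (fun x => f x * g x) := by
  classical
  intro ε hε
  obtain ⟨s, hs⟩ := hf (ε / (J + K + 1)) (by positivity)
  obtain ⟨s', hs'⟩ := hg (ε / (J + K + 1)) (by positivity)
  refine ⟨s ∪ s', fun x y hxy => ?_⟩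
  have h1 := hs x y (hxy.of_subset Finset.subset_union_left)
  have h2 := hs' x y (hxy.of_subset Finset.subset_union_right)
  rw [show f y * g y - f x * g x = f y * (g y - g x) + (f y - f x) * g x by ring]
  refine (abs_add_le _ _).trans ?_
  rw [abs_mul, abs_mul]
  calc |f y| * |g y - g x| + |f y - f x| * |g x|
      ≤ J * (ε / (J + K + 1)) + (ε / (J + K + 1)) * K :=
        add_le_add (mul_le_mul (hfJ y) h2 (abs_nonneg _) hJ)
          (mul_le_mul h1 (hgK x) (abs_nonneg _) (by positivity))
    _ = ε * (J + K) / (J + K + 1) := by ring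
    _ ≤ ε := by
        rw [div_le_iff₀ (by positivity)]
        nlinarith

lemma Regulated.inv (hU : Regulated U) (hc : 0 < c) (hcU : ∀ x, c ≤ U x) :
    Regulated (fun x => (U x)⁻¹) := by
  refine hU.of_controlled (C := (c ^ 2)⁻¹) (by positivity) fun x y η hxy _ h => ?_
  have h1 := h y hxy le_rfl
  have h3 : 0 < U x := hc.trans_le (hcU x)
  have h4 : 0 < U y := hc.trans_le (hcU y)
  rw [show (U y)⁻¹ - (U x)⁻¹ = (U y * U x)⁻¹ * -(U y - U x) by field_simp; ring,
    abs_mul, abs_neg, abs_of_pos (inv_pos.2 (mul_pos h4 h3))]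
  refine mul_le_mul (inv_anti₀ (by positivity) ?_) h1 (abs_nonneg _) (by positivity)
  rw [sq]
  exact mul_le_mul (hcU y) (hcU x) hc.le h4.le

lemma VarLE.const_mul {V : ℝ} (h : VarLE f V) (c : ℝ) : VarLE (fun x => c * f x) (|c| * V) := by
  intro u hu n
  refine le_trans (le_of_eq ?_) (mul_le_mul_of_nonneg_left (h u hu n) (abs_nonneg c))
  rw [seqVar, seqVar, Finset.mul_sum]
  exact Finset.sum_congr rfl fun i _ => by rw [← mul_sub, abs_mul]

variable [TopologicalSpace X] [OrderTopology X]

lemma Regulated.tendsto_leftLim (hf : Regulated f) (x : X) :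
    Tendsto f (𝓝[<] x) (𝓝 (Function.leftLim f x)) :=
  tendsto_leftLim_of_tendsto (hf.exists_tendsto x)

lemma Regulated.abs_leftLim_le (hf : Regulated f) (hK : ∀ x, |f x| ≤ K) (x : X) :
    |Function.leftLim f x| ≤ K := by
  rcases (𝓝[<] x).eq_or_neBot with hbot | hne
  · rw [leftLim_eq_of_eq_bot f hbot]
    exact hK x
  · exact le_of_tendsto (hf.tendsto_leftLim x).abs (Eventually.of_forall hK)

end Closure

/-! ### Transfer to `D[a, b]` and identification of the derivative. -/

section Cadlag

variable {a b : EReal}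

lemma IsCadlag.regulated {f : Icc a b → ℝ} (hf : IsCadlag f) : Regulated f :=
  regulated_of_cadlag hf.1 hf.2

lemma Regulated.isCadlag {f : Icc a b → ℝ} (hf : Regulated f) : IsCadlag f :=
  ⟨hf.continuousWithinAt, hf.exists_tendsto⟩

lemma CadlagSpace.regulated (f : CadlagSpace a b) : Regulated f :=
  IsCadlag.regulated f.2

lemma CadlagSpace.abs_apply_le (f : CadlagSpace a b) (x : Icc a b) : |f x| ≤ ‖f‖ :=
  lp.norm_apply_le_norm ENNReal.top_ne_zero (f : lp (fun _ : Icc a b => ℝ) ∞) x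

lemma CadlagSpace.abs_sub_apply_le (f g : CadlagSpace a b) (x : Icc a b) :
    |f x - g x| ≤ ‖f - g‖ :=
  CadlagSpace.abs_apply_le (f - g) x

lemma CadlagSpace.norm_le {f : CadlagSpace a b} {C : ℝ} (hC : 0 ≤ C) (h : ∀ x, |f x| ≤ C) :
    ‖f‖ ≤ C :=
  lp.norm_le_of_forall_le (f := (f : lp (fun _ : Icc a b => ℝ) ∞)) hC h

lemma CadlagSpace.ext {f g : CadlagSpace a b} (h : ∀ x, f x = g x) : f = g :=
  Subtype.ext (Subtype.ext (funext h))

/-- A bounded regulated function as an element of `D[a, b]`. -/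
noncomputable def Regulated.toCadlagSpace {f : Icc a b → ℝ} (hf : Regulated f) {K : ℝ}
    (hK : ∀ x, |f x| ≤ K) : CadlagSpace a b :=
  ⟨⟨f, memℓp_infty_iff.2 ⟨K, by rintro _ ⟨x, rfl⟩; exact hK x⟩⟩, hf.isCadlag⟩

lemma IsProdInt.hasProductIntegral (hab : a ≤ b) {A φ : Icc a b → ℝ}
    (h : IsProdInt ⟨a, left_mem_Icc.2 hab⟩ A φ) (t : Icc a b) : HasProductIntegral A t (φ t) := by
  intro ε hε
  obtain ⟨s, hs⟩ := h (ε / 2) (half_pos hε)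
  exact ⟨s, fun n u hu h0 hn hmem =>
    (hs t n u ⟨hu, Subtype.ext h0, hn, hmem⟩).trans_lt (half_lt_self hε)⟩

lemma HasProductIntegral.unique (hab : a ≤ b) {A : Icc a b → ℝ} {t : Icc a b} {p q : ℝ}
    (hp : HasProductIntegral A t p) (hq : HasProductIntegral A t q) : p = q := by
  classical
  refine sub_eq_zero.1 (abs_nonpos_iff.1 (le_of_forall_pos_le_add fun ε hε => ?_))
  obtain ⟨s, hs⟩ := hp (ε / 2) (half_pos hε)
  obtain ⟨s', hs'⟩ := hq (ε / 2) (half_pos hε)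
  obtain ⟨n, u, hu⟩ := exists_isRefined (o := ⟨a, left_mem_Icc.2 hab⟩) (fun x => x.2.1) (s ∪ s') t
  have h0 : (u 0 : EReal) = a := congrArg Subtype.val hu.zero
  have h1 := hs n u hu.mono h0 hu.last (hu.of_subset Finset.subset_union_left).mem
  have h2 := hs' n u hu.mono h0 hu.last (hu.of_subset Finset.subset_union_right).mem
  rw [abs_lt] at h1 h2
  rw [abs_le]
  constructor <;> linarith

/-- The limit found along refinements is regulated and bounded, hence an element of `D[a, b]`; by
uniqueness of limits the chosen element agrees with it and inherits convergence uniform in `t`. -/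
lemma isProdInt_productIntegral (hab : a ≤ b) {A : CadlagSpace a b} {M : ℝ} (hM : VarLE A M) :
    IsProdInt ⟨a, left_mem_Icc.2 hab⟩ A (productIntegral A) := by
  have ho : ∀ x : Icc a b, (⟨a, left_mem_Icc.2 hab⟩ : Icc a b) ≤ x := fun x => x.2.1
  obtain ⟨φ, hφ⟩ : ∃ φ, IsProdInt (⟨a, left_mem_Icc.2 hab⟩ : Icc a b) A φ :=
    exists_productIntegral ho (CadlagSpace.regulated A) hM
  have hex : ∃ F : CadlagSpace a b, ∀ t, HasProductIntegral A t (F t) :=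
    ⟨(hφ.regulated ho hM (CadlagSpace.regulated A)).toCadlagSpace (hφ.abs_le ho hM),
      hφ.hasProductIntegral hab⟩
  have heq : (productIntegral A : Icc a b → ℝ) = φ := by
    rw [productIntegral, dif_pos hex]
    exact funext fun t => (hex.choose_spec t).unique hab (hφ.hasProductIntegral hab t)
  rwa [heq]

/-- The integral `∫_{(a, t]} U₋ (U t / U) dα` is a limit of Riemann–Stieltjes sums. -/
lemma isRSInt_leftRightIntegral (hab : a ≤ b) {U α : Icc a b → ℝ} {c K J L : ℝ}
    (hU : Regulated U) (hα : Regulated α) (hc : 0 < c) (hcU : ∀ x, c ≤ U x)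
    (hUK : ∀ x, |U x| ≤ K) (hαJ : ∀ x, |α x| ≤ J) (hUL : VarLE U L) :
    IsRSInt ⟨a, left_mem_Icc.2 hab⟩ U (fun x => (U x)⁻¹) α (fun t =>
      leftRightIntegral U (fun u => U t / U u) α ⟨a, left_mem_Icc.2 hab⟩ t / U t) := by
  classical
  have ho : ∀ x : Icc a b, (⟨a, left_mem_Icc.2 hab⟩ : Icc a b) ≤ x := fun x => x.2.1
  set o : Icc a b := ⟨a, left_mem_Icc.2 hab⟩ with ho'
  have hK : 0 ≤ K := (abs_nonneg _).trans (hUK o)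
  have hJ : 0 ≤ J := (abs_nonneg _).trans (hαJ o)
  intro t ε hε
  have hUt : 0 < U t := hc.trans_le (hcU t)
  set V : Icc a b → ℝ := fun u => U t / U u with hV
  have hVeq : V = fun u => U t * (U u)⁻¹ := funext fun u => div_eq_mul_inv _ _
  have hinvc : ∀ x, |(U x)⁻¹| ≤ c⁻¹ := fun x => by
    rw [abs_of_pos (inv_pos.2 (hc.trans_le (hcU x)))]
    exact inv_anti₀ hc (hcU x)
  have hVreg : Regulated V := by
    rw [hVeq]
    exact (regulated_const (U t)).mul (hU.inv hc hcU) hK (by positivity) (fun _ => hUK t) hinvc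
  have hVK : ∀ x, |V x| ≤ K * c⁻¹ := fun x => by
    rw [hVeq, abs_mul]
    exact mul_le_mul (hUK t) (hinvc x) (abs_nonneg _) hK
  have hVbv : BoundedVariationOn V univ := by
    rw [hVeq]
    exact ((hUL.inv hc hcU).const_mul (U t)).boundedVariationOn
  have hUbv : BoundedVariationOn U univ := hUL.boundedVariationOn
  have hVα : ∀ x, |V x * α x| ≤ K * c⁻¹ * J := fun x => by
    rw [abs_mul]
    exact mul_le_mul (hVK x) (hαJ x) (abs_nonneg _) (by positivity)
  have hUα : ∀ x, |U x * α x| ≤ K * J := fun x => by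
    rw [abs_mul]
    exact mul_le_mul (hUK x) (hαJ x) (abs_nonneg _) hK
  have hUα' : ∀ x, |Function.leftLim U x * Function.leftLim α x| ≤ K * J := fun x => by
    rw [abs_mul]
    exact mul_le_mul (hU.abs_leftLim_le hUK x) (hα.abs_leftLim_le hαJ x) (abs_nonneg _) hK
  -- The factor `U t` is pulled out of the weight `U t / U`, so that the sums in the statement have
  -- weights independent of `t`.
  suffices H : ∀ ε : ℝ, 0 < ε → ∃ s : Finset (Icc a b), ∀ n u, IsRefined s o t n u →
      |rsSum (fun i => U (u i)) (fun i => V (u i)) (fun i => α (u i)) n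
        - leftRightIntegral U V α o t| ≤ ε by
    obtain ⟨s, hs⟩ := H (ε * U t) (mul_pos hε hUt)
    refine ⟨s, fun n u hu => ?_⟩
    have h1 := hs n u hu
    have h2 : rsSum (fun i => U (u i)) (fun i => V (u i)) (fun i => α (u i)) n =
        U t * rsSum (fun i => U (u i)) (fun i => (U (u i))⁻¹) (fun i => α (u i)) n := by
      rw [← rsSum_mid_const_mul, hVeq]
    rw [h2] at h1
    rw [show rsSum (fun i => U (u i)) (fun i => (U (u i))⁻¹) (fun i => α (u i)) n
        - leftRightIntegral U V α o t / U t
      = (U t * rsSum (fun i => U (u i)) (fun i => (U (u i))⁻¹) (fun i => α (u i)) n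
        - leftRightIntegral U V α o t) / U t by field_simp, abs_div, abs_of_pos hUt,
      div_le_iff₀ hUt]
    exact h1
  intro ε hε
  by_cases hbv : BoundedVariationOn α univ
  · obtain ⟨s, hs⟩ := exists_rsSum_sub_integral_le ho (K := max K (K * c⁻¹)) hU hU.tendsto_leftLim
      hVreg (fun x => (hUK x).trans (le_max_left _ _))
      (fun x => (hU.abs_leftLim_le hUK x).trans (le_max_left _ _))
      (fun x => (hVK x).trans (le_max_right _ _)) hα hbv hε
    refine ⟨s, fun n u hu => ?_⟩
    rw [leftRightIntegral, if_pos hbv, lsIntegral, dif_pos hbv]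
    exact hs t n u hu
  -- Summation by parts mirrors the defining formula: what remains are sums with integrators `V` and
  -- `U`, both of bounded variation. The constant `1` fills the unused weight, hence the maximum
  -- with `1`.
  · obtain ⟨s, hs⟩ := exists_rsSum_sub_integral_le ho (K := max (K * J) 1)
      (f := fun x => U x * α x) (g := fun _ => 1)
      (F := fun x => Function.leftLim U x * Function.leftLim α x)
      (hU.mul hα hK hJ hUK hαJ) (fun x => (hU.tendsto_leftLim x).mul (hα.tendsto_leftLim x))
      (regulated_const 1) (fun x => (hUα x).trans (le_max_left _ _))
      (fun x => (hUα' x).trans (le_max_left _ _)) (fun x => by simp) hVreg hVbv (half_pos hε)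
    obtain ⟨s', hs'⟩ := exists_rsSum_sub_integral_le ho (K := max (K * c⁻¹ * J) 1)
      (f := fun _ => 1) (F := fun _ => 1) (g := fun x => V x * α x)
      (regulated_const 1) (fun x => tendsto_const_nhds)
      (hVreg.mul hα (by positivity) hJ hVK hαJ) (fun x => by simp) (fun x => by simp)
      (fun x => (hVα x).trans (le_max_left _ _)) hU hUbv (half_pos hε)
    refine ⟨s ∪ s', fun n u hu => ?_⟩
    have h1 := hs t n u (hu.of_subset Finset.subset_union_left)
    have h2 := hs' t n u (hu.of_subset Finset.subset_union_right)
    rw [leftRightIntegral, if_neg hbv, lsIntegral, dif_pos hVbv, lsIntegral, dif_pos hUbv,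
      rsSum_by_parts, hu.zero, hu.last]
    simp only [mul_one, one_mul] at h1 h2
    change |_ - _ - rsSum _ (fun _ => 1) _ n - rsSum (fun _ => 1) _ _ n - _| ≤ ε
    rw [abs_le] at *
    constructor <;> linarith

/-- The bounded linear map with values `∫_{(a, t]} U₋ (U t / U) dα`. -/
lemma exists_continuousLinearMap_leftRightIntegral (hab : a ≤ b) (U : CadlagSpace a b)
    {c K L : ℝ} (hc : 0 < c) (hcU : ∀ x, c ≤ U x) (hUK : ∀ x, |U x| ≤ K)
    (hψK : ∀ x, |(U x)⁻¹| ≤ K) (hUL : VarLE U L) (hψL : VarLE (fun x => (U x)⁻¹) L) :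
    ∃ T : CadlagSpace a b →L[ℝ] CadlagSpace a b, ∀ (α : CadlagSpace a b) (t : Icc a b),
      T α t = leftRightIntegral U (fun u => U t / U u) α ⟨a, left_mem_Icc.2 hab⟩ t := by
  have ho : ∀ x : Icc a b, (⟨a, left_mem_Icc.2 hab⟩ : Icc a b) ≤ x := fun x => x.2.1
  have hK : 0 ≤ K := (abs_nonneg _).trans (hUK ⟨a, left_mem_Icc.2 hab⟩)
  have hL : 0 ≤ L := hUL.nonneg ⟨a, left_mem_Icc.2 hab⟩
  have hU0 : ∀ x, U x ≠ 0 := fun x => (hc.trans_le (hcU x)).ne'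
  obtain ⟨G, hG⟩ : ∃ G : CadlagSpace a b → Icc a b → ℝ, ∀ α t, G α t =
      leftRightIntegral U (fun u => U t / U u) α ⟨a, left_mem_Icc.2 hab⟩ t :=
    ⟨_, fun _ _ => rfl⟩
  have hH : ∀ α : CadlagSpace a b, IsRSInt (⟨a, left_mem_Icc.2 hab⟩ : Icc a b) U
      (fun x => (U x)⁻¹) α (fun t => G α t / U t) := fun α => by
    simp only [hG]
    exact isRSInt_leftRightIntegral hab (CadlagSpace.regulated U) (CadlagSpace.regulated α) hc hcU
      hUK (CadlagSpace.abs_apply_le α) hUL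
  have hGmul : ∀ α t, G α t = U t * (G α t / U t) := fun α t => by
    rw [mul_div_cancel₀ _ (hU0 t)]
  set D := 2 * K * (K + L) with hD
  have hD0 : 0 ≤ D := by positivity
  have hHb : ∀ (α : CadlagSpace a b) t, |G α t / U t| ≤ D * ‖α‖ := fun α t =>
    (hH α).abs_le ho hUK hψK hUL hψL (CadlagSpace.abs_apply_le α) t
  have hGb : ∀ (α : CadlagSpace a b) t, |G α t| ≤ K * D * ‖α‖ := fun α t => by
    rw [hGmul, abs_mul, mul_assoc]
    exact mul_le_mul (hUK t) (hHb α t) (abs_nonneg _) hK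
  have hGreg : ∀ α, Regulated (G α) := fun α => by
    have h1 := (hH α).regulated ho hUK hψK hUL hψL (CadlagSpace.regulated α)
    have h2 := (CadlagSpace.regulated U).mul h1 hK (mul_nonneg hD0 (norm_nonneg α)) hUK (hHb α)
    rwa [← (funext (hGmul α) : G α = _)] at h2
  -- The case distinction in `leftRightIntegral` hides linearity; it follows from uniqueness of the
  -- limit of sums that are linear in the integrator.
  have hGadd : ∀ α β t, G (α + β) t = G α t + G β t := fun α β t => by
    have h1 : G (α + β) t / U t = G α t / U t + G β t / U t :=
      (hH (α + β)).unique ho ((hH α).add (hH β)) t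
    rw [hGmul, h1, mul_add, ← hGmul, ← hGmul]
  have hGsmul : ∀ (r : ℝ) α t, G (r • α) t = r * G α t := fun r α t => by
    have h1 : G (r • α) t / U t = r * (G α t / U t) :=
      (hH (r • α)).unique ho ((hH α).const_mul r) t
    rw [hGmul, h1, mul_left_comm, ← hGmul]
  let T : CadlagSpace a b →ₗ[ℝ] CadlagSpace a b :=
    { toFun := fun α => (hGreg α).toCadlagSpace (hGb α)
      map_add' := fun α β => CadlagSpace.ext (hGadd α β)
      map_smul' := fun r α => CadlagSpace.ext (hGsmul r α) }
  exact ⟨T.mkContinuous (K * D) fun α =>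
    CadlagSpace.norm_le (mul_nonneg (mul_nonneg hK hD0) (norm_nonneg α)) (hGb α), hG⟩

end Cadlag

/-! ### The main theorem. -/

theorem mainTheorem8 {a b : EReal} (hab : a ≤ b) (M : ℝ≥0) :
    (∀ A ∈ BVGtNegOne a b M,
      (∀ t, HasProductIntegral A t (productIntegral A t)) ∧
      BoundedVariationOn (productIntegral A) univ ∧
      ∃ c : ℝ, 0 < c ∧ ∀ t, c ≤ productIntegral A t) ∧
    ∀ A ∈ BVGtNegOne a b M, ∃ φ' : CadlagSpace a b →L[ℝ] CadlagSpace a b,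
      (∀ (α : CadlagSpace a b) (t : Icc a b),
        φ' α t = leftRightIntegral (productIntegral A)
          (fun u => productIntegral A t / productIntegral A u) α ⟨a, left_mem_Icc.2 hab⟩ t) ∧
      HasUniformHadamardDerivAt productIntegral (BVGtNegOne a b M) φ' A := by
  have ho : ∀ x : Icc a b, (⟨a, left_mem_Icc.2 hab⟩ : Icc a b) ≤ x := fun x => x.2.1
  have hvar : ∀ A ∈ BVGtNegOne a b M, VarLE A M := fun A hA => varLE_of_eVariationOn_le hA.1
  have hpos : ∀ A ∈ BVGtNegOne a b M, ∃ c : ℝ, 0 < c ∧ ∀ t, c ≤ productIntegral A t := by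
    rintro A hA
    obtain ⟨δ, hδ, hjump⟩ := hA.2
    exact (isProdInt_productIntegral hab (hvar A hA)).exists_pos_le ho (hvar A hA)
      (CadlagSpace.regulated A) (CadlagSpace.regulated A).tendsto_leftLim hδ hjump
  refine ⟨fun A hA => ?_, fun A hA => ?_⟩
  · have h := isProdInt_productIntegral hab (hvar A hA)
    obtain ⟨L, hL⟩ := h.exists_varLE ho (hvar A hA)
    exact ⟨h.hasProductIntegral hab, hL.boundedVariationOn, hpos A hA⟩
  have hAM := hvar A hA
  have hprod := isProdInt_productIntegral hab hAM
  obtain ⟨c, hc, hcU⟩ := hpos A hA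
  set U := productIntegral A with hU
  obtain ⟨L₁, hL₁⟩ := hprod.exists_varLE ho hAM
  have hUK : ∀ x, |U x| ≤ max (Real.exp M) c⁻¹ := fun x =>
    (hprod.abs_le ho hAM x).trans (le_max_left _ _)
  have hψK : ∀ x, |(U x)⁻¹| ≤ max (Real.exp M) c⁻¹ := fun x => by
    rw [abs_of_pos (inv_pos.2 (hc.trans_le (hcU x)))]
    exact (inv_anti₀ hc (hcU x)).trans (le_max_right _ _)
  have hUL : VarLE U (max L₁ (L₁ / c ^ 2)) := fun u hu n =>
    (hL₁ u hu n).trans (le_max_left _ _)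
  have hψL : VarLE (fun x => (U x)⁻¹) (max L₁ (L₁ / c ^ 2)) := fun u hu n =>
    ((hL₁.inv hc hcU) u hu n).trans (le_max_right _ _)
  have hU0 : ∀ x, U x ≠ 0 := fun x => (hc.trans_le (hcU x)).ne'
  obtain ⟨T, hT⟩ :=
    exists_continuousLinearMap_leftRightIntegral hab U hc hcU hUK hψK hUL hψL
  refine ⟨T, hT, hA, ?_⟩
  have hH : ∀ α : CadlagSpace a b, IsRSInt (⟨a, left_mem_Icc.2 hab⟩ : Icc a b) U
      (fun x => (U x)⁻¹) α (fun t => T α t / U t) := fun α => by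
    simp only [hT]
    exact isRSInt_leftRightIntegral hab (CadlagSpace.regulated U) (CadlagSpace.regulated α) hc hcU
      hUK (CadlagSpace.abs_apply_le α) hUL
  intro τ h θ h₀ hτ hτ0 hh hθ hθS hθS'
  obtain ⟨C, hC, hbound⟩ := exists_hadamard_bound ho hprod hAM
    (fun x => mul_inv_cancel₀ (hU0 x)) hUK hψK hUL hψL
  rw [tendsto_iff_norm_sub_tendsto_zero] at hh hθ
  have hθ' : Tendsto (fun n => ‖θ n - A‖ + |τ n| * (‖h n - h₀‖ + ‖h₀‖)) atTop (𝓝 0) := by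
    simpa using hθ.add (hτ0.abs.mul (hh.add_const ‖h₀‖))
  have hθle : ∀ n x, |(θ n + τ n • h n : CadlagSpace a b) x - A x| ≤
      ‖θ n - A‖ + |τ n| * (‖h n - h₀‖ + ‖h₀‖) := by
    intro n x
    have h1 := CadlagSpace.abs_sub_apply_le (θ n) A x
    have h2 : |h n x| ≤ ‖h n - h₀‖ + ‖h₀‖ := by
      have h3 := CadlagSpace.abs_sub_apply_le (h n) h₀ x
      have h4 := CadlagSpace.abs_apply_le h₀ x
      have h5 := abs_add_le (h n x - h₀ x) (h₀ x)
      rw [sub_add_cancel] at h5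
      linarith
    change |θ n x + τ n * h n x - A x| ≤ _
    rw [show θ n x + τ n * h n x - A x = (θ n x - A x) + τ n * h n x by ring]
    refine (abs_add_le _ _).trans (add_le_add h1 ?_)
    rw [abs_mul]
    exact mul_le_mul_of_nonneg_left h2 (abs_nonneg _)
  refine Metric.tendsto_nhds.2 fun e he => ?_
  -- One `ε` is for the distance from `h n` to `h₀`, the other for the approximation `β`. The
  -- variation `V` depends on `ε`, so `η` is chosen only after `β`.
  obtain ⟨ε, hε0, hCε⟩ : ∃ ε : ℝ, 0 < ε ∧ C * (ε + ε) ≤ e / 2 := by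
    refine ⟨e / (4 * (C + 1)), by positivity, ?_⟩
    rw [show C * (e / (4 * (C + 1)) + e / (4 * (C + 1))) = e * C / (2 * (C + 1)) by
      field_simp; ring, div_le_div_iff₀ (by positivity) two_pos]
    nlinarith
  obtain ⟨β, V, hβ, hV⟩ := (CadlagSpace.regulated h₀).exists_step ho
    (CadlagSpace.abs_apply_le h₀) hε0
  have hV0 : 0 ≤ V := hV.nonneg ⟨a, left_mem_Icc.2 hab⟩
  obtain ⟨η, hη0, hCη⟩ : ∃ η : ℝ, 0 < η ∧ C * V * η ≤ e / 4 := by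
    refine ⟨e / (4 * (C * V + 1)), by positivity, ?_⟩
    have h1 : 0 ≤ C * V := by positivity
    rw [mul_div_assoc', div_le_div_iff₀ (by positivity) four_pos]
    nlinarith
  filter_upwards [hh.eventually (gt_mem_nhds hε0), hθ.eventually (gt_mem_nhds hη0),
    hθ'.eventually (gt_mem_nhds hη0)] with n h1 h2 h3
  rw [dist_eq_norm]
  refine lt_of_le_of_lt (CadlagSpace.norm_le (C := e / 2 + e / 4) (by positivity) fun t => ?_)
    (by linarith)
  have h4 := hbound h₀ (fun t => T h₀ t / U t) β V ε (hH h₀) hβ hV (θ n) (productIntegral (θ n))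
    (θ n + τ n • h n : CadlagSpace a b) (productIntegral (θ n + τ n • h n)) (h n) (τ n) ε η
    (isProdInt_productIntegral hab (hvar _ (hθS n))) (hvar _ (hθS n))
    (isProdInt_productIntegral hab (hvar _ (hθS' n))) (hvar _ (hθS' n)) (hτ n) (fun x => rfl)
    (fun x => (CadlagSpace.abs_sub_apply_le (θ n) A x).trans h2.le)
    (fun x => (hθle n x).trans h3.le)
    (fun x => (CadlagSpace.abs_sub_apply_le (h n) h₀ x).trans h1.le) t
  rw [mul_div_cancel₀ _ (hU0 t)] at h4
  exact h4.trans (by linarith)
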